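/- **Setting.** For $x,y\in\mathbb R^2$ let $\langle x;y\rangle=x_1y_1-x_2y_2$, and let $\Lambda_v=\begin{pmatrix}\cosh v&\sinh v\\ \sinh v&\cosh v\end{pmatrix}$ for $v\in\mathbb R$. The affine Poincaré group $\mathcal P$ is the set of all $g=(b,a,v)$ with $b\in\mathbb R^2$, $a>0$, $v\in\mathbb R$, with the product $(b,a,v)*(b',a',v')=(b+a\Lambda_vb',aa',v+v')$, left Haar measure $d\mu=a^{-3}\,db\,da\,dv$ and modular function $\Delta(b,a,v)=a^{-2}$; $L^p(\mathcal P)$ means $L^p(\mathcal P,\mu)$. Let $$C_1^1=\{x_1^2>x_2^2,\ x_1>0\},\quad C_2^1=\{x_1^2>x_2^2,\ -x_1>0\},\quad C_1^2=\{x_1^2<x_2^2,\ x_2>0\},\quad C_2^2=\{x_1^2<x_2^2,\ -x_2>0\}$$ be the four open cones in $\mathbb R^2$. For $i,j\in\{1,2\}$ let $\pi_i^j$ be the unitary representation of $\mathcal P$ on $L^2(C_i^j)$ (Lebesgue measure) given by $$(\pi_i^j(b,a,v)\varphi)(x)=a\,e^{i\langle x;b\rangle}\varphi(a\Lambda_{-v}x),$$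 and let $D_i^j$ be the unbounded self-adjoint operator of multiplication by $\frac1{2\pi}|\langle x;x\rangle|^{1/2}$ on $L^2(C_i^j)$, with its maximal domain. For $f\in L^1(\mathcal P)\cap L^2(\mathcal P)$ let $\widehat f(\pi_i^j)$ be the bounded operator on $L^2(C_i^j)$ with $$(\widehat f(\pi_i^j)\varphi)(x)=\int_{\mathcal P}f(g)\,\big(\pi_i^j(g)(D_i^j\varphi)\big)(x)\,d\mu(g)\quad\text{for a.e. }x,\qquad \varphi\in\operatorname{dom}D_i^j,$$ and extend $f\mapsto\widehat f(\pi_i^j)$ by continuity to $L^2(\mathcal P)$. For $1\le r<\infty$, $S_r(C_i^j)$ is the Schatten class of compact operators on $L^2(C_i^j)$ with $r$-summable singular values, with norm the $\ell^r$ norm of the singular values; $S_\infty(C_i^j)$ is the space of all bounded operators with the operator norm. A symbol $\sigma$ assigns to each $g\in\mathcal P$ and each $i,j\in\{1,2\}$ a bounded operator $\sigma(g,\pi_i^j)$ on $L^2(C_i^j)$, such that $g\mapsto\langle\sigma(g,\pi_i^j)\varphi,\psi\rangle_{L^2(C_i^j)}$ is $\mu$-measurable for all $\varphi,\psi\in L^2(C_i^j)$.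 Its pseudo-differential operator is $$(T_\sigma f)(g)=\Delta(g)^{-1/2}\sum_{i,j=1}^2\operatorname{Tr}\Big[D_i^j\sigma(g,\pi_i^j)\,\widehat f(\pi_i^j)\,\pi_i^j(g)^*\Big].$$ **Theorem ($L^2$–$L^p$ boundedness, $2\le p\le\infty$).** Let $2\le p\le\infty$ and $\frac1p+\frac1q=1$. Let $\sigma$ be a symbol such that, for all $g\in\mathcal P$ and $i,j\in\{1,2\}$, $\sigma(g,\pi_i^j)$ maps $L^2(C_i^j)$ into $\operatorname{dom}D_i^j$ and $D_i^j\sigma(g,\pi_i^j)\in S_q(C_i^j)$. Suppose that the functions $$G_i^j(g)=\Delta(g)^{-1/2}\,\|D_i^j\sigma(g,\pi_i^j)\|_{S_q(C_i^j)}$$ belong to $L^p(\mathcal P)$ for $i,j=1,2$. Then, for all $f\in L^2(\mathcal P)$, $g\in\mathcal P$ and $i,j$, the operator $D_i^j\sigma(g,\pi_i^j)\widehat f(\pi_i^j)\pi_i^j(g)^*$ is of trace class, $T_\sigma$ is a bounded linear operator from $L^2(\mathcal P)$ to $L^p(\mathcal P)$, and $$\|T_\sigma\|_{B(L^2(\mathcal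 P),L^p(\mathcal P))}\le\|G_1^1\|_{L^p(\mathcal P)}+\|G_2^1\|_{L^p(\mathcal P)}+\|G_1^2\|_{L^p(\mathcal P)}+\|G_2^2\|_{L^p(\mathcal P)}.$$ -/

import Mathlib

open MeasureTheory Filter Topology
open scoped ENNReal

noncomputable section

/-! ## The affine Poincare group -/

/-- Elements `(b, a, v)` of the affine Poincare group: `b ∈ ℝ²`, `a > 0`, `v ∈ ℝ`. -/
@[ext]
structure AffPoincare where
  b : ℝ × ℝ
  a : ℝ
  v : ℝ
  a_pos : 0 < a

namespace AffPoincare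

/-- The hyperbolic rotation `Λ_v` of the plane. -/
def boost (v : ℝ) (x : ℝ × ℝ) : ℝ × ℝ :=
  (Real.cosh v * x.1 + Real.sinh v * x.2, Real.sinh v * x.1 + Real.cosh v * x.2)

/-- The Minkowski inner product `⟨x;y⟩ = x₁y₁ - x₂y₂`. -/
def mink (x y : ℝ × ℝ) : ℝ := x.1 * y.1 - x.2 * y.2

/-- `(b,a,v) * (b',a',v') = (b + a Λ_v b', a a', v + v')`. -/
instance : Mul AffPoincare :=
  ⟨fun g h => ⟨g.b + g.a • boost g.v h.b, g.a * h.a, g.v + h.v, mul_pos g.a_pos h.a_pos⟩⟩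

instance : One AffPoincare := ⟨⟨0, 1, 0, one_pos⟩⟩

/-- `(b,a,v)⁻¹ = (-a⁻¹ Λ_{-v} b, a⁻¹, -v)`. -/
instance : Inv AffPoincare :=
  ⟨fun g => ⟨-(g.a⁻¹ • boost (-g.v) g.b), g.a⁻¹, -g.v, inv_pos.2 g.a_pos⟩⟩

theorem mul_def (g h : AffPoincare) :
    g * h = ⟨g.b + g.a • boost g.v h.b, g.a * h.a, g.v + h.v, mul_pos g.a_pos h.a_pos⟩ := rfl

theorem one_def : (1 : AffPoincare) = ⟨0, 1, 0, one_pos⟩ := rfl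

theorem inv_def (g : AffPoincare) :
    g⁻¹ = ⟨-(g.a⁻¹ • boost (-g.v) g.b), g.a⁻¹, -g.v, inv_pos.2 g.a_pos⟩ := rfl

instance : Group AffPoincare :=
  Group.ofLeftAxioms
    (by
      intro g h k
      simp only [mul_def, AffPoincare.mk.injEq]
      refine ⟨?_, by ring, by ring⟩
      ext <;> simp [boost, Real.cosh_add, Real.sinh_add] <;> ring)
    (by
      intro g
      simp [mul_def, one_def, boost])
    (by
      intro g
      have h := g.a_pos.ne'
      simp [mul_def, one_def, inv_def, h])

/-- The coordinates `(b, a, v)` as a point of `ℝ² × ℝ × ℝ`. -/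
def coords (g : AffPoincare) : (ℝ × ℝ) × ℝ × ℝ := (g.b, g.a, g.v)

instance : MeasurableSpace AffPoincare := MeasurableSpace.comap coords inferInstance

/-- The coordinate map is a measurable isomorphism onto `{a > 0}`. -/
theorem measurableEmbedding_coords : MeasurableEmbedding coords where
  injective := by
    intro g h hgh
    simp only [coords, Prod.mk.injEq] at hgh
    exact AffPoincare.ext hgh.1 hgh.2.1 hgh.2.2
  measurable := comap_measurable coords
  measurableSet_image' := by
    rintro s ⟨t, ht, rfl⟩
    have : coords '' (coords ⁻¹' t) = t ∩ {x : (ℝ × ℝ) × ℝ × ℝ | 0 < x.2.1} := by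
      rw [Set.image_preimage_eq_inter_range]
      congr 1
      ext x
      constructor
      · rintro ⟨g, rfl⟩
        exact g.a_pos
      · intro hx
        exact ⟨⟨x.1, x.2.1, x.2.2, hx⟩, rfl⟩
    rw [this]
    exact ht.inter (measurableSet_lt measurable_const (by fun_prop))

/-- The left Haar measure `db da dv / a³`. -/
def haar : Measure AffPoincare :=
  (Measure.comap coords volume).withDensity fun g => ENNReal.ofReal (1 / g.a ^ 3)

/-- The modular function `Δ(b, a, v) = 1 / a²`. -/
def modular (g : AffPoincare) : ℝ := 1 / g.a ^ 2

/-! ## The four open cones and the representations -/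

/-- The cone `C_i^j` is `cone (i - 1) (j - 1)`. -/
def cone : Fin 2 → Fin 2 → Set (ℝ × ℝ)
  | 0, 0 => {x | x.1 ^ 2 > x.2 ^ 2 ∧ 0 < x.1}
  | 1, 0 => {x | x.1 ^ 2 > x.2 ^ 2 ∧ 0 < -x.1}
  | 0, 1 => {x | x.1 ^ 2 < x.2 ^ 2 ∧ 0 < x.2}
  | 1, 1 => {x | x.1 ^ 2 < x.2 ^ 2 ∧ 0 < -x.2}

/-- Lebesgue measure on the cone `C_i^j`. -/
abbrev coneMeasure (i j : Fin 2) : Measure (ℝ × ℝ) := volume.restrict (cone i j)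

/-- The Hilbert space `L²(C_i^j)`. -/
abbrev ConeL2 (i j : Fin 2) : Type := Lp ℂ 2 (coneMeasure i j)

/-- The map `x ↦ a Λ_{-v} x` of the plane attached to `g = (b, a, v)`. -/
def dil (g : AffPoincare) (x : ℝ × ℝ) : ℝ × ℝ := g.a • boost (-g.v) x

/-- The action of `π(b, a, v)` on functions: `x ↦ a e^{i⟨x;b⟩} φ(a Λ_{-v} x)`. -/
def piFun (g : AffPoincare) (φ : ℝ × ℝ → ℂ) (x : ℝ × ℝ) : ℂ :=
  g.a * Complex.exp (Complex.I * mink x g.b) * φ (dil g x)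

theorem measurable_dil (g : AffPoincare) : Measurable (dil g) := by
  unfold dil boost
  fun_prop

theorem measurableSet_cone (i j : Fin 2) : MeasurableSet (cone i j) := by
  have h1 : Measurable fun x : ℝ × ℝ => x.1 := measurable_fst
  have h2 : Measurable fun x : ℝ × ℝ => x.2 := measurable_snd
  have h0 : Measurable fun _ : ℝ × ℝ => (0 : ℝ) := measurable_const
  fin_cases i <;> fin_cases j
  · exact (measurableSet_lt (h2.pow_const 2) (h1.pow_const 2)).inter (measurableSet_lt h0 h1)
  · exact (measurableSet_lt (h1.pow_const 2) (h2.pow_const 2)).inter (measurableSet_lt h0 h2)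
  · exact (measurableSet_lt (h2.pow_const 2) (h1.pow_const 2)).inter (measurableSet_lt h0 h1.neg)
  · exact (measurableSet_lt (h1.pow_const 2) (h2.pow_const 2)).inter (measurableSet_lt h0 h2.neg)

theorem sq_sub_sq_dil (g : AffPoincare) (x : ℝ × ℝ) :
    (dil g x).1 ^ 2 - (dil g x).2 ^ 2 = g.a ^ 2 * (x.1 ^ 2 - x.2 ^ 2) := by
  have h := Real.cosh_sq (-g.v)
  simp only [dil, boost, Prod.smul_mk, smul_eq_mul]
  linear_combination (g.a ^ 2 * (x.1 ^ 2 - x.2 ^ 2)) * h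

theorem pos_boost_aux (v s t : ℝ) (h : t ^ 2 < s ^ 2) :
    0 < Real.cosh v * s + Real.sinh v * t ↔ 0 < s := by
  have hc := Real.cosh_pos v
  have hcs : Real.sinh v ^ 2 < Real.cosh v ^ 2 := by
    have := Real.cosh_sq v
    linarith
  have key : (Real.sinh v * t) ^ 2 < (Real.cosh v * s) ^ 2 := by
    rw [mul_pow, mul_pow]
    have h1 : Real.sinh v ^ 2 * t ^ 2 ≤ Real.cosh v ^ 2 * t ^ 2 :=
      mul_le_mul_of_nonneg_right hcs.le (sq_nonneg t)
    have h2 : Real.cosh v ^ 2 * t ^ 2 < Real.cosh v ^ 2 * s ^ 2 :=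
      mul_lt_mul_of_pos_left h (by positivity)
    linarith
  have habs := sq_lt_sq.1 key
  constructor
  · intro hp
    by_contra hs
    have hs' : Real.cosh v * s ≤ 0 := mul_nonpos_of_nonneg_of_nonpos hc.le (not_lt.1 hs)
    rw [abs_of_nonpos hs'] at habs
    have := le_abs_self (Real.sinh v * t)
    linarith
  · intro hs
    rw [abs_of_pos (mul_pos hc hs)] at habs
    have := neg_abs_le (Real.sinh v * t)
    linarith

/-- The cones are invariant under dilations and hyperbolic rotations. -/
theorem dil_preimage_cone (g : AffPoincare) (i j : Fin 2) : dil g ⁻¹' cone i j = cone i j := by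
  have ha := g.a_pos
  have ha2 : 0 < g.a ^ 2 := by positivity
  ext x
  have hq := sq_sub_sq_dil g x
  have e1 : (dil g x).2 ^ 2 < (dil g x).1 ^ 2 ↔ x.2 ^ 2 < x.1 ^ 2 := by
    rw [← sub_pos, hq, mul_pos_iff_of_pos_left ha2, sub_pos]
  have e2 : (dil g x).1 ^ 2 < (dil g x).2 ^ 2 ↔ x.1 ^ 2 < x.2 ^ 2 := by
    rw [← sub_neg, hq, ← sub_neg (a := x.1 ^ 2), mul_neg_iff]
    constructor
    · rintro (h | h)
      · exact h.2
      · linarith [h.1]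
    · exact fun h => Or.inl ⟨ha2, h⟩
  have d1 : (dil g x).1 = g.a * (Real.cosh (-g.v) * x.1 + Real.sinh (-g.v) * x.2) := rfl
  have d2 : (dil g x).2 = g.a * (Real.cosh (-g.v) * x.2 + Real.sinh (-g.v) * x.1) := by
    simp only [dil, boost, Prod.smul_mk, smul_eq_mul]
    ring
  have n1 : -(dil g x).1 = g.a * (Real.cosh (-g.v) * (-x.1) + Real.sinh (-g.v) * (-x.2)) := by
    rw [d1]; ring
  have n2 : -(dil g x).2 = g.a * (Real.cosh (-g.v) * (-x.2) + Real.sinh (-g.v) * (-x.1)) := by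
    rw [d2]; ring
  fin_cases i <;> fin_cases j <;>
    simp only [cone, Fin.zero_eta, Fin.mk_one, Set.mem_preimage, Set.mem_ofPred_eq, gt_iff_lt]
  · rw [e1]
    refine and_congr_right fun h => ?_
    rw [d1, mul_pos_iff_of_pos_left ha, pos_boost_aux _ _ _ h]
  · rw [e2]
    refine and_congr_right fun h => ?_
    rw [d2, mul_pos_iff_of_pos_left ha, pos_boost_aux _ _ _ h]
  · rw [e1]
    refine and_congr_right fun h => ?_
    rw [n1, mul_pos_iff_of_pos_left ha, pos_boost_aux _ _ _ (by simpa using h)]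
  · rw [e2]
    refine and_congr_right fun h => ?_
    rw [n2, mul_pos_iff_of_pos_left ha, pos_boost_aux _ _ _ (by simpa using h)]

theorem map_dil_volume (g : AffPoincare) :
    Measure.map (dil g) (volume : Measure (ℝ × ℝ)) = ENNReal.ofReal ((g.a ^ 2)⁻¹) • volume := by
  set M : Matrix (Fin 2) (Fin 2) ℝ :=
    !![g.a * Real.cosh (-g.v), g.a * Real.sinh (-g.v);
      g.a * Real.sinh (-g.v), g.a * Real.cosh (-g.v)] with hM
  have hf : dil g = Matrix.toLin (Module.Basis.finTwoProd ℝ) (Module.Basis.finTwoProd ℝ) M := by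
    funext x
    rw [hM, Matrix.toLin_finTwoProd_apply]
    simp only [dil, boost, Prod.smul_mk, smul_eq_mul, Prod.mk.injEq]
    constructor <;> ring
  have hdet : LinearMap.det
      (Matrix.toLin (Module.Basis.finTwoProd ℝ) (Module.Basis.finTwoProd ℝ) M) = g.a ^ 2 := by
    rw [LinearMap.det_toLin, hM, Matrix.det_fin_two_of]
    linear_combination g.a ^ 2 * Real.cosh_sq (-g.v)
  have hpos : 0 < g.a ^ 2 := pow_pos g.a_pos 2
  rw [hf, Measure.map_linearMap_addHaar_eq_smul_addHaar _ (by rw [hdet]; exact hpos.ne'), hdet,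
    abs_of_pos (inv_pos.2 hpos)]

theorem map_dil_coneMeasure (g : AffPoincare) (i j : Fin 2) :
    Measure.map (dil g) (coneMeasure i j) = ENNReal.ofReal ((g.a ^ 2)⁻¹) • coneMeasure i j := by
  unfold coneMeasure
  rw [← Measure.restrict_smul, ← map_dil_volume,
    Measure.restrict_map (measurable_dil g) (measurableSet_cone i j), dil_preimage_cone]

theorem quasiMeasurePreserving_dil (g : AffPoincare) (i j : Fin 2) :
    Measure.QuasiMeasurePreserving (dil g) (coneMeasure i j) (coneMeasure i j) :=
  ⟨measurable_dil g, by
    rw [map_dil_coneMeasure]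
    exact Measure.smul_absolutelyContinuous⟩

theorem aestronglyMeasurable_piFun (g : AffPoincare) {i j : Fin 2} (φ : ConeL2 i j) :
    AEStronglyMeasurable (piFun g φ) (coneMeasure i j) := by
  have h1 : AEStronglyMeasurable (fun x => φ (dil g x)) (coneMeasure i j) :=
    (Lp.aestronglyMeasurable φ).comp_quasiMeasurePreserving (quasiMeasurePreserving_dil g i j)
  have h2 : Measurable fun x : ℝ × ℝ => (g.a : ℂ) * Complex.exp (Complex.I * mink x g.b) := by
    unfold mink
    fun_prop
  exact h2.aestronglyMeasurable.mul h1

theorem eLpNorm_piFun (g : AffPoincare) {i j : Fin 2} (φ : ConeL2 i j) :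
    eLpNorm (piFun g φ) 2 (coneMeasure i j) = eLpNorm φ 2 (coneMeasure i j) := by
  have ha := g.a_pos
  have h1 : eLpNorm (piFun g φ) 2 (coneMeasure i j)
      = eLpNorm ((g.a : ℂ) • fun x => φ (dil g x)) 2 (coneMeasure i j) := by
    apply eLpNorm_congr_norm_ae
    refine Eventually.of_forall fun x => ?_
    simp only [piFun, Pi.smul_apply, smul_eq_mul, norm_mul]
    rw [mul_comm Complex.I, Complex.norm_exp_ofReal_mul_I, mul_one]
  have h2 : eLpNorm (fun x => φ (dil g x)) 2 (coneMeasure i j)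
      = ENNReal.ofReal (g.a⁻¹) * eLpNorm φ 2 (coneMeasure i j) := by
    have hm : AEStronglyMeasurable φ (Measure.map (dil g) (coneMeasure i j)) := by
      rw [map_dil_coneMeasure]
      exact (Lp.aestronglyMeasurable φ).mono_ac Measure.smul_absolutelyContinuous
    have := eLpNorm_map_measure (p := 2) hm (measurable_dil g).aemeasurable
    rw [map_dil_coneMeasure, eLpNorm_smul_measure_of_ne_top (by simp)] at this
    rw [show (fun x => φ (dil g x)) = φ ∘ dil g from rfl, ← this, smul_eq_mul]
    congr 1
    rw [ENNReal.ofReal_rpow_of_pos (by positivity)]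
    congr 1
    rw [← inv_pow, ← Real.rpow_natCast, ← Real.rpow_mul (by positivity)]
    norm_num
  rw [h1, eLpNorm_const_smul, h2, ← mul_assoc, ← ofReal_norm, Complex.norm_real,
    Real.norm_of_nonneg ha.le, ← ENNReal.ofReal_mul ha.le, mul_inv_cancel₀ ha.ne',
    ENNReal.ofReal_one, one_mul]

theorem memLp_piFun (g : AffPoincare) {i j : Fin 2} (φ : ConeL2 i j) :
    MemLp (piFun g φ) 2 (coneMeasure i j) :=
  ⟨aestronglyMeasurable_piFun g φ, by
    rw [eLpNorm_piFun]
    exact (Lp.memLp φ).2⟩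

/-- The representation operator `π_i^j(b, a, v)` on `L²(C_i^j)`:
`(π_i^j(b, a, v) φ)(x) = a e^{i⟨x;b⟩} φ(a Λ_{-v} x)`. -/
def piOp (i j : Fin 2) (g : AffPoincare) : ConeL2 i j →L[ℂ] ConeL2 i j :=
  LinearMap.mkContinuous
    { toFun := fun φ => (memLp_piFun g φ).toLp (piFun g φ)
      map_add' := by
        intro φ ψ
        rw [← MemLp.toLp_add]
        apply MemLp.toLp_congr
        filter_upwards [(quasiMeasurePreserving_dil g i j).ae_eq_comp (Lp.coeFn_add φ ψ)]
          with x hx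
        simp only [Function.comp_apply, Pi.add_apply] at hx
        simp only [piFun, Pi.add_apply, hx]
        ring
      map_smul' := by
        intro c φ
        rw [RingHom.id_apply, ← MemLp.toLp_const_smul]
        apply MemLp.toLp_congr
        filter_upwards [(quasiMeasurePreserving_dil g i j).ae_eq_comp (Lp.coeFn_smul c φ)]
          with x hx
        simp only [Function.comp_apply, Pi.smul_apply, smul_eq_mul] at hx
        simp only [piFun, Pi.smul_apply, smul_eq_mul, hx]
        ring }
    1 (by
      intro φ
      simp only [LinearMap.coe_mk, AddHom.coe_mk, Lp.norm_toLp, one_mul]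
      rw [eLpNorm_piFun, Lp.norm_def])

/-! ## The Duflo-Moore operators -/

/-- The multiplier `(2π)⁻¹ |⟨x;x⟩|^{1/2}`. -/
def dufloWeight (x : ℝ × ℝ) : ℝ := 1 / (2 * Real.pi) * Real.sqrt |mink x x|

/-- `(Dφ)(x) = (2π)⁻¹ |⟨x;x⟩|^{1/2} φ(x)` on functions. -/
def dufloFun (φ : ℝ × ℝ → ℂ) (x : ℝ × ℝ) : ℂ := dufloWeight x * φ x

/-- The Duflo-Moore operator `D_i^j`, the unbounded operator on `L²(C_i^j)` of multiplication by
`(2π)⁻¹ |⟨x;x⟩|^{1/2}` with its maximal domain. -/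
def dufloMoore (i j : Fin 2) : ConeL2 i j →ₗ.[ℂ] ConeL2 i j where
  domain :=
    { carrier := {φ | MemLp (dufloFun φ) 2 (coneMeasure i j)}
      add_mem' := by
        intro φ ψ hφ hψ
        refine (memLp_congr_ae ?_).2 (MemLp.add hφ hψ)
        filter_upwards [Lp.coeFn_add φ ψ] with x hx
        simp only [dufloFun, Pi.add_apply, hx]
        ring
      zero_mem' := by
        refine (memLp_congr_ae ?_).2 (MemLp.zero (p := 2) (μ := coneMeasure i j) (ε := ℂ))
        filter_upwards [Lp.coeFn_zero ℂ 2 (coneMeasure i j)] with x hx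
        simp only [dufloFun, hx, Pi.zero_apply, mul_zero]
      smul_mem' := by
        intro c φ hφ
        refine (memLp_congr_ae ?_).2 (MemLp.const_smul hφ c)
        filter_upwards [Lp.coeFn_smul c φ] with x hx
        simp only [dufloFun, Pi.smul_apply, smul_eq_mul, hx]
        ring }
  toFun :=
    { toFun := fun φ => MemLp.toLp (dufloFun φ.1) φ.2
      map_add' := by
        intro φ ψ
        rw [← MemLp.toLp_add]
        apply MemLp.toLp_congr
        filter_upwards [Lp.coeFn_add φ.1 ψ.1] with x hx
        simp only [dufloFun, Pi.add_apply, Submodule.coe_add, hx]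
        ring
      map_smul' := by
        intro c φ
        rw [RingHom.id_apply, ← MemLp.toLp_const_smul]
        apply MemLp.toLp_congr
        filter_upwards [Lp.coeFn_smul c φ.1] with x hx
        simp only [dufloFun, Pi.smul_apply, smul_eq_mul, Submodule.coe_smul, hx]
        ring }

theorem dufloMoore_coeFn {i j : Fin 2} (φ : (dufloMoore i j).domain) :
    (dufloMoore i j φ : ℝ × ℝ → ℂ) =ᵐ[coneMeasure i j] dufloFun φ.1 :=
  MemLp.coeFn_toLp φ.2

/-- The graph of the Duflo-Moore operator is sequentially closed. -/
theorem dufloMoore_closed {i j : Fin 2} (u : ℕ → (dufloMoore i j).domain)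
    (x : (dufloMoore i j).domain) (y : ConeL2 i j)
    (hx : Tendsto (fun n => (u n : ConeL2 i j)) atTop (𝓝 (x : ConeL2 i j)))
    (hy : Tendsto (fun n => dufloMoore i j (u n)) atTop (𝓝 y)) : y = dufloMoore i j x := by
  obtain ⟨ns, hns, h1⟩ := (tendstoInMeasure_of_tendsto_Lp hx).exists_seq_tendsto_ae
  obtain ⟨ms, hms, h2⟩ :=
    (tendstoInMeasure_of_tendsto_Lp (hy.comp hns.tendsto_atTop)).exists_seq_tendsto_ae
  have h3 : ∀ᵐ z ∂coneMeasure i j, ∀ n, dufloMoore i j (u n) z = dufloFun (u n).1 z :=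
    ae_all_iff.2 fun n => dufloMoore_coeFn (u n)
  apply Lp.ext
  filter_upwards [h1, h2, h3, dufloMoore_coeFn x] with z h1 h2 h3 h4
  rw [h4]
  refine tendsto_nhds_unique h2 ?_
  simp only [Function.comp_apply, h3, dufloFun]
  exact (h1.comp hms.tendsto_atTop).const_mul _

/-- The product `D_i^j S` of the Duflo-Moore operator and a bounded operator `S` that maps into the
domain of `D_i^j`; it is bounded by the closed graph theorem. -/
def dufloComp {i j : Fin 2} (S : ConeL2 i j →L[ℂ] ConeL2 i j)
    (hS : ∀ φ, S φ ∈ (dufloMoore i j).domain) : ConeL2 i j →L[ℂ] ConeL2 i j :=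
  ContinuousLinearMap.ofSeqClosedGraph
    (g := (dufloMoore i j).toFun.comp ((S : ConeL2 i j →ₗ[ℂ] ConeL2 i j).codRestrict _ hS))
    (by
      intro u x y hu hy
      exact dufloMoore_closed (fun n => ⟨S (u n), hS _⟩) ⟨S x, hS x⟩ y
        ((S.continuous.tendsto x).comp hu) hy)

/-! ## The group Fourier transform -/

/-- The Fourier transform of `f ∈ L¹ ∩ L²`: the bounded operator `A` on `L²(C_i^j)` with
`(Aφ)(x) = ∫ f(g) (π_i^j(g) (D_i^j φ))(x) dμ(g)` for almost every `x`, for all `φ` in the domain of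
`D_i^j` (this domain is dense, so there is at most one such `A`). -/
def fourierL1 (i j : Fin 2) (f : AffPoincare → ℂ) : ConeL2 i j →L[ℂ] ConeL2 i j :=
  open Classical in
  if h : ∃ A : ConeL2 i j →L[ℂ] ConeL2 i j, ∀ φ ∈ (dufloMoore i j).domain,
      A φ =ᵐ[coneMeasure i j] fun x => ∫ g, f g * piFun g (dufloFun φ) x ∂haar
  then h.choose else 0

/-- The Fourier transform `f̂(π_i^j)` of `f ∈ L²`: the extension by continuity of the Fourier
transform from `L¹ ∩ L²` to `L²`. -/
def fourier (i j : Fin 2) : Lp ℂ 2 haar → (ConeL2 i j →L[ℂ] ConeL2 i j) :=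
  extendFrom {h : Lp ℂ 2 haar | Integrable h haar} fun h => fourierL1 i j h

end AffPoincare

/-! ## Schatten classes and the trace -/

section Schatten

variable {H : Type*} [NormedAddCommGroup H] [InnerProductSpace ℂ H] [CompleteSpace H]

/-- The multiplicity of `s > 0` as a singular value of `T`: the dimension of the eigenspace
of `T* T` for the eigenvalue `s²`. -/
def singularMultiplicity (T : H →L[ℂ] H) (s : ℝ) : ℕ :=
  Module.finrank ℂ (Module.End.eigenspace
    ((ContinuousLinearMap.adjoint T ∘L T : H →L[ℂ] H) : H →ₗ[ℂ] H) ((s ^ 2 : ℝ) : ℂ))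

/-- The Schatten `p`-norm of a compact operator, the `ℓ^p` norm of its nonzero singular values
counted with multiplicity; for `p = ∞` it is the operator norm of a bounded operator. -/
def schattenENorm (p : ℝ≥0∞) (T : H →L[ℂ] H) : ℝ≥0∞ :=
  if p = ∞ then ‖T‖ₑ
  else (∑' s : {s : ℝ // 0 < s},
    (singularMultiplicity T s : ℝ≥0∞) * ENNReal.ofReal s ^ p.toReal) ^ (1 / p.toReal)

/-- The Schatten class `S_p`: compact operators with `p`-summable singular values, and all
bounded operators for `p = ∞`. -/
def MemSchatten (p : ℝ≥0∞) (T : H →L[ℂ] H) : Prop :=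
  (p ≠ ∞ → IsCompactOperator T) ∧ schattenENorm p T < ∞

/-- The Schatten norm as a real number. -/
def schattenNorm (p : ℝ≥0∞) (T : H →L[ℂ] H) : ℝ := (schattenENorm p T).toReal

/-- The trace `∑ ⟨T e, e⟩` over an orthonormal basis; for `T` in the trace class `S_1` the sum
converges absolutely and does not depend on the basis. -/
def opTrace (T : H →L[ℂ] H) : ℂ :=
  ∑' e : (exists_hilbertBasis ℂ H).choose, inner ℂ (e : H) (T e)

end Schatten

/-! ## Pseudo-differential operators -/

namespace AffPoincare

/-- An operator-valued symbol: `σ i j g` is the bounded operator `σ(g, π_i^j)` on `L²(C_i^j)`. -/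
abbrev OpSymbol : Type := ∀ i j : Fin 2, AffPoincare → ConeL2 i j →L[ℂ] ConeL2 i j

/-- The operator `D_i^j σ(g, π_i^j) f̂(π_i^j) π_i^j(g)*`. -/
def symbolOp (σ : OpSymbol) (hσ : ∀ i j g φ, σ i j g φ ∈ (dufloMoore i j).domain)
    (f : Lp ℂ 2 haar) (g : AffPoincare) (i j : Fin 2) : ConeL2 i j →L[ℂ] ConeL2 i j :=
  dufloComp (σ i j g) (hσ i j g) ∘L fourier i j f ∘L ContinuousLinearMap.adjoint (piOp i j g)

/-- `(T_σ f)(g) = Δ(g)^{-1/2} ∑_{i,j} Tr [D_i^j σ(g, π_i^j) f̂(π_i^j) π_i^j(g)*]`. -/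
def pseudoDiff (σ : OpSymbol) (hσ : ∀ i j g φ, σ i j g φ ∈ (dufloMoore i j).domain)
    (f : Lp ℂ 2 haar) (g : AffPoincare) : ℂ :=
  ((modular g ^ (-(1 / 2) : ℝ) : ℝ) : ℂ) * ∑ i, ∑ j, opTrace (symbolOp σ hσ f g i j)

/-- `G_i^j(g) = Δ(g)^{-1/2} ‖D_i^j σ(g, π_i^j)‖_{S_q}`. -/
def symbolNorm (q : ℝ≥0∞) (σ : OpSymbol)
    (hσ : ∀ i j g φ, σ i j g φ ∈ (dufloMoore i j).domain) (i j : Fin 2) (g : AffPoincare) : ℝ :=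
  modular g ^ (-(1 / 2) : ℝ) * schattenNorm q (dufloComp (σ i j g) (hσ i j g))

end AffPoincare

end

/-! Since $p\ge 2$, the conjugate exponent satisfies $1\le q\le 2$, so $S_q\subset S_2$ with a
norm-decreasing inclusion (`hsENorm_le_schattenENorm`). The Fourier transform sends $L^2(\mathcal
P)$ into the Hilbert-Schmidt operators without increasing the norm (`hsENorm_fourierCLM_le`), and
$\pi(g)^*$ is a contraction. Cauchy-Schwarz for Hilbert-Schmidt operators (`enorm_opTrace_comp_le`)
bounds each trace by $\|D\sigma(g,\pi)\|_{S_q}\|f\|$, whence $|T_\sigma f|\le\|f\|\sum G_i^j$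
pointwise (`norm_pseudoDiff_le`). The triangle inequality in $L^p$ gives the norm bound. The
products are of trace class because they are products of two Hilbert-Schmidt operators
(`schattenENorm_one_comp_le`).

The substance is the Plancherel inequality. Let $f\in L^1\cap L^2$, let $F(x,a,v)$ be its Fourier
transform in $b$ for the Minkowski pairing, and $w$ the multiplier of $D$. By Fubini $(\widehat
f\varphi)(x)=\int F\,w(x)\,a^2\,\varphi(a\Lambda_{-v}x)\,a^{-3}\,da\,dv$. The map $(a,v)\mapsto
a\Lambda_{-v}x$ is a bijection onto the cone of $x$ with Jacobian $a|\langle x;x\rangle|$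
(`measurePreserving_orbitMap`), so $\widehat f$ is an integral operator. As $w^2=|\langle
x;x\rangle|/4\pi^2$ cancels the Jacobian, its kernel at $x$ has squared norm at most
$(4\pi^2)^{-1}\int|F|^2a^{-3}\,da\,dv$ (`exists_kernel`). By Plancherel in $b$ this density
integrates over the whole plane to $\|f\|^2$ (`lintegral_fourierDensity`); one cone gives an
inequality. Density of $L^1\cap L^2$ does the rest.

Measurability of $T_\sigma f$ follows by expanding the traces in a countable basis and moving $D$ to
the other side of the inner product, on its dense domain. -/

noncomputable section

/-! ### Sums of extended nonnegative reals. -/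

namespace ENNReal

/-- The Cauchy-Schwarz inequality for sums of extended nonnegative reals. -/
theorem tsum_mul_le_sqrt_mul_sqrt {ι : Type*} (f g : ι → ℝ≥0∞) :
    ∑' i, f i * g i ≤ (∑' i, f i ^ 2) ^ (1 / 2 : ℝ) * (∑' i, g i ^ 2) ^ (1 / 2 : ℝ) := by
  rw [ENNReal.tsum_eq_iSup_sum]
  refine iSup_le fun s => ?_
  have h := ENNReal.inner_le_Lp_mul_Lq s f g (p := 2) (q := 2) Real.HolderConjugate.two_two
  refine h.trans ?_
  simp only [ENNReal.rpow_ofNat]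
  gcongr <;> exact ENNReal.sum_le_tsum s

theorem sq_rpow_half (x : ℝ≥0∞) : (x ^ 2) ^ (1 / 2 : ℝ) = x := by
  rw [← ENNReal.rpow_natCast, ← ENNReal.rpow_mul]
  norm_num

theorem rpow_half_sq (x : ℝ≥0∞) : (x ^ (1 / 2 : ℝ)) ^ 2 = x := by
  rw [← ENNReal.rpow_natCast, ← ENNReal.rpow_mul]
  norm_num

end ENNReal

/-! ### Hilbert-Schmidt operators. -/

section HilbertSchmidt

variable {H : Type*} [NormedAddCommGroup H] [InnerProductSpace ℂ H]

theorem HilbertBasis.tsum_enorm_inner_sq {ι : Type*} (b : HilbertBasis ι ℂ H) (x : H) :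
    ∑' i, ‖inner ℂ (b i) x‖ₑ ^ 2 = ‖x‖ₑ ^ 2 := by
  have h := b.hasSum_inner_mul_inner x x
  have h2 : HasSum (fun i => ‖inner ℂ (b i) x‖ ^ 2) (‖x‖ ^ 2) := by
    have := Complex.reCLM.hasSum h
    simp only [Complex.reCLM_apply] at this
    convert! this using 1
    · ext i
      rw [← inner_conj_symm x, Complex.conj_mul', ← Complex.ofReal_pow, Complex.ofReal_re]
    · rw [inner_self_eq_norm_sq_to_K]
      norm_cast
  have h3 : ∀ y : ℂ, ‖y‖ₑ ^ 2 = ENNReal.ofReal (‖y‖ ^ 2) := fun y => by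
    rw [← ofReal_norm, ENNReal.ofReal_pow (norm_nonneg _)]
  simp_rw [h3]
  rw [← ENNReal.ofReal_tsum_of_nonneg (fun i => sq_nonneg _) h2.summable, h2.tsum_eq,
    ← ofReal_norm, ENNReal.ofReal_pow (norm_nonneg _)]

theorem Orthonormal.tsum_enorm_inner_sq_le {ι : Type*} {v : ι → H} (hv : Orthonormal ℂ v) (x : H) :
    ∑' i, ‖inner ℂ (v i) x‖ₑ ^ 2 ≤ ‖x‖ₑ ^ 2 := by
  have h3 : ∀ y : ℂ, ‖y‖ₑ ^ 2 = ENNReal.ofReal (‖y‖ ^ 2) := fun y => by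
    rw [← ofReal_norm, ENNReal.ofReal_pow (norm_nonneg _)]
  simp_rw [h3]
  rw [← ENNReal.ofReal_tsum_of_nonneg (fun i => sq_nonneg _) (hv.inner_products_summable x),
    ← ofReal_norm, ← ENNReal.ofReal_pow (norm_nonneg _)]
  exact ENNReal.ofReal_le_ofReal (hv.tsum_inner_products_le x)

variable [CompleteSpace H]

/-- The Hilbert-Schmidt norm of a bounded operator. -/
def hsENorm (T : H →L[ℂ] H) : ℝ≥0∞ :=
  (∑' e : (exists_hilbertBasis ℂ H).choose, ‖T (e : H)‖ₑ ^ 2) ^ (1 / 2 : ℝ)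

/-- By Parseval both sides are the double sum of the squared matrix coefficients, and in
$[0,\infty]$ the order of summation is free. -/
theorem tsum_enorm_adjoint_sq {ι κ : Type*} (b : HilbertBasis ι ℂ H) (c : HilbertBasis κ ℂ H)
    (T : H →L[ℂ] H) :
    ∑' i, ‖T (b i)‖ₑ ^ 2 = ∑' j, ‖ContinuousLinearMap.adjoint T (c j)‖ₑ ^ 2 := by
  simp_rw [← c.tsum_enorm_inner_sq (T (b _)), ← b.tsum_enorm_inner_sq
    (ContinuousLinearMap.adjoint T (c _))]
  rw [ENNReal.tsum_comm]
  refine tsum_congr fun j => tsum_congr fun i => ?_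
  rw [ContinuousLinearMap.adjoint_inner_right, ← inner_conj_symm, RCLike.enorm_conj]

/-- Passing to the adjoint twice replaces the chosen basis by an arbitrary one. -/
theorem hsENorm_sq {ι : Type*} (b : HilbertBasis ι ℂ H) (T : H →L[ℂ] H) :
    hsENorm T ^ 2 = ∑' i, ‖T (b i)‖ₑ ^ 2 := by
  obtain ⟨c, hc⟩ := (exists_hilbertBasis ℂ H).choose_spec
  have h : hsENorm T ^ 2 = ∑' i, ‖T (c i)‖ₑ ^ 2 := by
    rw [hsENorm, ENNReal.rpow_half_sq, hc]
  rw [h, tsum_enorm_adjoint_sq c b T, ← tsum_enorm_adjoint_sq b b T]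

theorem hsENorm_eq {ι : Type*} (b : HilbertBasis ι ℂ H) (T : H →L[ℂ] H) :
    hsENorm T = (∑' i, ‖T (b i)‖ₑ ^ 2) ^ (1 / 2 : ℝ) := by
  rw [← hsENorm_sq b T, ENNReal.sq_rpow_half]

theorem hsENorm_adjoint (T : H →L[ℂ] H) :
    hsENorm (ContinuousLinearMap.adjoint T) = hsENorm T := by
  obtain ⟨c, -⟩ := (exists_hilbertBasis ℂ H).choose_spec
  rw [hsENorm_eq c, hsENorm_eq c, tsum_enorm_adjoint_sq c c T]

/-- The argument of `tsum_enorm_adjoint_sq` with Bessel's inequality in place of Parseval, since `u`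
need not be complete. -/
theorem Orthonormal.tsum_enorm_sq_le {ι : Type*} {u : ι → H} (hu : Orthonormal ℂ u)
    (T : H →L[ℂ] H) : (∑' i, ‖T (u i)‖ₑ ^ 2) ^ (1 / 2 : ℝ) ≤ hsENorm T := by
  obtain ⟨c, -⟩ := (exists_hilbertBasis ℂ H).choose_spec
  rw [← hsENorm_adjoint, hsENorm_eq c]
  gcongr ?_ ^ _
  simp_rw [← c.tsum_enorm_inner_sq (T (u _))]
  rw [ENNReal.tsum_comm]
  refine ENNReal.tsum_le_tsum fun j => ?_
  refine le_trans (le_of_eq ?_) (hu.tsum_enorm_inner_sq_le _)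
  refine tsum_congr fun i => ?_
  rw [ContinuousLinearMap.adjoint_inner_right, ← inner_conj_symm, RCLike.enorm_conj]

theorem hsENorm_comp_le_left (A B : H →L[ℂ] H) : hsENorm (A ∘L B) ≤ ‖A‖ₑ * hsENorm B := by
  obtain ⟨c, -⟩ := (exists_hilbertBasis ℂ H).choose_spec
  rw [hsENorm_eq c, hsENorm_eq c, ← ENNReal.sq_rpow_half ‖A‖ₑ,
    ← ENNReal.mul_rpow_of_nonneg _ _ (by norm_num), ← ENNReal.tsum_mul_left]
  gcongr ?_ ^ _
  refine ENNReal.tsum_le_tsum fun i => ?_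
  rw [← mul_pow]
  gcongr
  exact A.le_opENorm _

theorem hsENorm_comp_le_right (A B : H →L[ℂ] H) : hsENorm (A ∘L B) ≤ hsENorm A * ‖B‖ₑ := by
  rw [← hsENorm_adjoint, ContinuousLinearMap.adjoint_comp, mul_comm, ← hsENorm_adjoint A]
  refine (hsENorm_comp_le_left _ _).trans (le_of_eq ?_)
  rw [← ofReal_norm, ← ofReal_norm, LinearIsometryEquiv.norm_map]

theorem enorm_le_hsENorm (T : H →L[ℂ] H) : ‖T‖ₑ ≤ hsENorm T := by
  refine T.opENorm_le_bound  fun x => ?_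
  rcases eq_or_ne x 0 with rfl | hx
  · simp
  have hx' : ‖x‖ ≠ 0 := norm_ne_zero_iff.2 hx
  -- A normalized vector is an orthonormal family with one member.
  have hu : Orthonormal ℂ (fun _ : Unit => ((‖x‖⁻¹ : ℝ) : ℂ) • x) := by
    refine ⟨fun _ => ?_, fun i j h => (h (Subsingleton.elim _ _)).elim⟩
    rw [norm_smul]
    simp [hx']
  have h := hu.tsum_enorm_sq_le T
  simp only [tsum_fintype, Finset.univ_unique, Finset.sum_singleton] at h
  rw [ENNReal.sq_rpow_half] at h
  calc ‖T x‖ₑ = ‖T (((‖x‖⁻¹ : ℝ) : ℂ) • x)‖ₑ * ‖x‖ₑ := by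
        rw [map_smul, ← ofReal_norm, ← ofReal_norm, ← ofReal_norm,
          ← ENNReal.ofReal_mul (norm_nonneg _), norm_smul]
        congr 1
        simp
        field_simp
    _ ≤ _ := by gcongr

/-- The Hilbert-Schmidt inequality for the matrix coefficients of a product. -/
theorem tsum_enorm_inner_comp_le {ι : Type*} {u v : ι → H} (hu : Orthonormal ℂ u)
    (hv : Orthonormal ℂ v) (A B : H →L[ℂ] H) :
    ∑' i, ‖inner ℂ (v i) ((A ∘L B) (u i))‖ₑ ≤ hsENorm A * hsENorm B := by
  calc ∑' i, ‖inner ℂ (v i) ((A ∘L B) (u i))‖ₑ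
      ≤ ∑' i, ‖ContinuousLinearMap.adjoint A (v i)‖ₑ * ‖B (u i)‖ₑ := by
        refine ENNReal.tsum_le_tsum fun i => ?_
        rw [ContinuousLinearMap.comp_apply, ← ContinuousLinearMap.adjoint_inner_left,
          ← ofReal_norm, ← ofReal_norm, ← ofReal_norm, ← ENNReal.ofReal_mul (norm_nonneg _)]
        exact ENNReal.ofReal_le_ofReal (norm_inner_le_norm _ _)
    _ ≤ _ := ENNReal.tsum_mul_le_sqrt_mul_sqrt _ _
    _ ≤ _ := by
        rw [← hsENorm_adjoint A]
        gcongr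
        · exact hv.tsum_enorm_sq_le _
        · exact hu.tsum_enorm_sq_le _

theorem orthonormal_hilbertBasis_choose :
    Orthonormal ℂ (fun e : (exists_hilbertBasis ℂ H).choose => (e : H)) := by
  obtain ⟨c, hc⟩ := (exists_hilbertBasis ℂ H).choose_spec
  rw [← hc]
  exact c.orthonormal

theorem tsum_enorm_opTrace_comp_le (A B : H →L[ℂ] H) :
    ∑' e : (exists_hilbertBasis ℂ H).choose, ‖inner ℂ (e : H) ((A ∘L B) e)‖ₑ
      ≤ hsENorm A * hsENorm B :=
  tsum_enorm_inner_comp_le orthonormal_hilbertBasis_choose orthonormal_hilbertBasis_choose A B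

/-! ### Comparison with the Schatten norms -/

theorem isSymmetric_adjoint_comp_self (T : H →L[ℂ] H) :
    ((ContinuousLinearMap.adjoint T ∘L T : H →L[ℂ] H) : H →ₗ[ℂ] H).IsSymmetric :=
  (ContinuousLinearMap.isSelfAdjoint_iff_isSymmetric.1 (IsSelfAdjoint.star_mul_self T))

theorem isCompactOperator_adjoint_comp_self {T : H →L[ℂ] H} (hT : IsCompactOperator T) :
    IsCompactOperator (ContinuousLinearMap.adjoint T ∘L T : H →L[ℂ] H) :=
  hT.clm_comp (ContinuousLinearMap.adjoint T)

/-- `Module.finrank` is 0 on infinite-dimensional spaces, so `singularMultiplicity` is a true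
dimension only thanks to compactness. -/
theorem finiteDimensional_singularSpace {T : H →L[ℂ] H} (hT : IsCompactOperator T) {μ : ℂ}
    (hμ : μ ≠ 0) : FiniteDimensional ℂ (Module.End.eigenspace
      ((ContinuousLinearMap.adjoint T ∘L T : H →L[ℂ] H) : H →ₗ[ℂ] H) μ) :=
  ContinuousLinearMap.finite_dimensional_eigenspace (isCompactOperator_adjoint_comp_self hT) μ hμ

/-- A product of two Hilbert-Schmidt operators is of trace class. -/
theorem schattenENorm_one_comp_le (A B : H →L[ℂ] H) (hAB : IsCompactOperator (A ∘L B)) :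
    schattenENorm 1 (A ∘L B) ≤ hsENorm A * hsENorm B := by
  set C := A ∘L B with hC
  set S : H →ₗ[ℂ] H := ((ContinuousLinearMap.adjoint C ∘L C : H →L[ℂ] H) : H →ₗ[ℂ] H) with hS
  have hne : ∀ s : {s : ℝ // 0 < s}, (((s : ℝ) ^ 2 : ℝ) : ℂ) ≠ 0 := fun s => by
    simpa using s.2.ne'
  have hfin : ∀ s : {s : ℝ // 0 < s},
      FiniteDimensional ℂ (Module.End.eigenspace S (((s : ℝ) ^ 2 : ℝ) : ℂ)) := fun s =>
    finiteDimensional_singularSpace hAB (hne s)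
  let α : {s : ℝ // 0 < s} → Type := fun s => Fin (singularMultiplicity C s)
  -- Right singular vectors: orthonormal bases of all eigenspaces of $C^*C$ with eigenvalue $s^2>0$,
  -- put together.
  let u : (Σ s, α s) → H := fun a =>
    (stdOrthonormalBasis ℂ (Module.End.eigenspace S (((a.1 : ℝ) ^ 2 : ℝ) : ℂ)) a.2 : H)
  have hinj : Function.Injective fun s : {s : ℝ // 0 < s} => (((s : ℝ) ^ 2 : ℝ) : ℂ) := by
    intro s t hst
    have : (s : ℝ) ^ 2 = (t : ℝ) ^ 2 := Complex.ofReal_injective hst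
    exact Subtype.ext ((pow_left_inj₀ s.2.le t.2.le two_ne_zero).1 this)
  have hu : Orthonormal ℂ u :=
    ((isSymmetric_adjoint_comp_self C).orthogonalFamily_eigenspaces.comp
      hinj).orthonormal_sigma_orthonormal
      (v_family := fun s => stdOrthonormalBasis ℂ (Module.End.eigenspace S (((s : ℝ) ^ 2 : ℝ) : ℂ)))
      (fun s => (stdOrthonormalBasis ℂ _).orthonormal)
  have hSu : ∀ a, ContinuousLinearMap.adjoint C (C (u a)) = (((a.1 : ℝ) ^ 2 : ℝ) : ℂ) • u a :=
    fun a => Module.End.mem_eigenspace_iff.1 (stdOrthonormalBasis ℂ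
      (Module.End.eigenspace S (((a.1 : ℝ) ^ 2 : ℝ) : ℂ)) a.2).2
  -- Left singular vectors $s^{-1}Cu$. Then $\langle v,Cu\rangle=s$, so the sum of the singular
  -- values is a sum of matrix coefficients of $AB$, to which the Hilbert-Schmidt inequality
  -- applies.
  let v : (Σ s, α s) → H := fun a => (((a.1 : ℝ)⁻¹ : ℝ) : ℂ) • C (u a)
  have hCC : ∀ a b, inner ℂ (C (u a)) (C (u b)) = (((b.1 : ℝ) ^ 2 : ℝ) : ℂ) * inner ℂ (u a) (u b) :=
    fun a b => by
      rw [← ContinuousLinearMap.adjoint_inner_right, hSu, inner_smul_right]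
  have hv : Orthonormal ℂ v := by
    classical
    rw [orthonormal_iff_ite] at hu ⊢
    intro a b
    simp only [v]
    rw [inner_smul_left, inner_smul_right, hCC, hu a b]
    split_ifs with hab
    · subst hab
      have : ((a.1 : ℝ) : ℂ) ≠ 0 := by exact_mod_cast a.1.2.ne'
      rw [Complex.conj_ofReal]
      push_cast
      field_simp
    · simp
  have key := tsum_enorm_inner_comp_le hu hv A B
  refine le_trans (le_of_eq ?_) key
  rw [schattenENorm, if_neg ENNReal.one_ne_top]
  simp only [ENNReal.toReal_one, ENNReal.rpow_one, div_one]
  rw [ENNReal.tsum_sigma']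
  refine tsum_congr fun s => ?_
  have h1 : ∀ k : α s, ‖inner ℂ (v ⟨s, k⟩) (C (u ⟨s, k⟩))‖ₑ = ENNReal.ofReal s := by
    intro k
    have : ((s : ℝ) : ℂ) ≠ 0 := by exact_mod_cast s.2.ne'
    have hn : inner ℂ (u ⟨s, k⟩) (u ⟨s, k⟩) = (1 : ℂ) := by
      rw [inner_self_eq_norm_sq_to_K, hu.1]; simp
    have : inner ℂ (v ⟨s, k⟩) (C (u ⟨s, k⟩)) = ((s : ℝ) : ℂ) := by
      simp only [v]
      rw [inner_smul_left, hCC, hn, Complex.conj_ofReal]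
      push_cast
      field_simp
    rw [this, ← ofReal_norm, Complex.norm_real, Real.norm_of_nonneg s.2.le]
  rw [tsum_congr h1, tsum_fintype]
  simp [α]

/-- By the spectral theorem the eigenvectors of $T^*T$ supply a Hilbert basis, and $\|Te\|^2$ is the
eigenvalue of $e$. The eigenvalue 0, whose eigenspace may be infinite-dimensional, contributes
nothing. -/
theorem hsENorm_sq_le_tsum {T : H →L[ℂ] H} (hT : IsCompactOperator T) :
    hsENorm T ^ 2 ≤ ∑' s : {s : ℝ // 0 < s},
      (singularMultiplicity T s : ℝ≥0∞) * ENNReal.ofReal s ^ 2 := by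
  set S : H →L[ℂ] H := ContinuousLinearMap.adjoint T ∘L T with hS
  let K : ℂ → Submodule ℂ H := fun μ => Module.End.eigenspace (S : H →ₗ[ℂ] H) μ
  have hclosed : ∀ μ, IsClosed (K μ : Set H) := by
    intro μ
    have : (K μ : Set H) = {x | S x = μ • x} := by
      ext x
      exact Module.End.mem_eigenspace_iff
    rw [this]
    exact isClosed_eq S.continuous (continuous_const_smul μ)
  have hcomp : ∀ μ, CompleteSpace (K μ) := fun μ => (hclosed μ).completeSpace_coe
  choose w b hb using fun μ => exists_hilbertBasis ℂ (K μ)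
  let v : (Σ μ, w μ) → H := fun a => (b a.1 a.2 : H)
  have hv : Orthonormal ℂ v :=
    (isSymmetric_adjoint_comp_self T).orthogonalFamily_eigenspaces.orthonormal_sigma_orthonormal
      (v_family := fun μ => b μ) (fun μ => (b μ).orthonormal)
  have hsp : (Submodule.span ℂ (Set.range v))ᗮ = ⊥ := by
    rw [eq_bot_iff, ← ContinuousLinearMap.orthogonalComplement_iSup_eigenspaces_eq_bot
      (isCompactOperator_adjoint_comp_self hT) (isSymmetric_adjoint_comp_self T)]
    intro x hx
    rw [Submodule.mem_orthogonal] at hx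
    rw [← Submodule.iInf_orthogonal, Submodule.mem_iInf]
    intro μ
    rw [Submodule.mem_orthogonal]
    intro y hy
    -- Each vector of an eigenspace is the limit of its basis expansion, so orthogonality to `v`
    -- implies orthogonality to the whole eigenspace.
    have hd : (K μ) ≤ (Submodule.span ℂ (Set.range v)).topologicalClosure := by
      intro z hz
      have h1 := (b μ).hasSum_repr ⟨z, hz⟩
      have h2 := (K μ).subtypeL.hasSum h1
      refine (Submodule.isClosed_topologicalClosure _).mem_of_tendsto h2
        (Eventually.of_forall fun s => ?_)
      refine Submodule.sum_mem _ fun i _ => ?_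
      rw [map_smul]
      refine Submodule.smul_mem _ _ (Submodule.le_topologicalClosure _ (Submodule.subset_span ?_))
      exact ⟨⟨μ, i⟩, rfl⟩
    have hx' : x ∈ (Submodule.span ℂ (Set.range v)).topologicalClosureᗮ := by
      rw [Submodule.orthogonal_closure]
      exact (Submodule.mem_orthogonal _ _).2 hx
    exact (Submodule.mem_orthogonal _ _).1 hx' y (hd hy)
  let c := HilbertBasis.mkOfOrthogonalEqBot hv hsp
  have hc : ⇑c = v := HilbertBasis.coe_mkOfOrthogonalEqBot _ _
  have hpos : ∀ a : Σ μ, w μ, a.1 = ((‖T (v a)‖ ^ 2 : ℝ) : ℂ) := by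
    intro a
    have h1 : S (v a) = a.1 • v a := Module.End.mem_eigenspace_iff.1 (Subtype.mem _)
    have h2 : inner ℂ (T (v a)) (T (v a)) = a.1 := by
      rw [← ContinuousLinearMap.adjoint_inner_right]
      change inner ℂ (v a) (S (v a)) = _
      rw [h1, inner_smul_right, inner_self_eq_norm_sq_to_K, hv.1]
      simp
    conv_lhs => rw [← h2, inner_self_eq_norm_sq_to_K]
    norm_cast
  have hnorm : ∀ a, ‖T (v a)‖ₑ ^ 2 = ‖a.1‖ₑ := by
    intro a
    rw [hpos a, ← ofReal_norm, ← ofReal_norm, Complex.norm_real,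
      Real.norm_of_nonneg (sq_nonneg _), ENNReal.ofReal_pow (norm_nonneg _)]
  rw [hsENorm_sq c, hc]
  simp_rw [hnorm]
  rw [ENNReal.tsum_sigma']
  have hinj : Function.Injective fun s : {s : ℝ // 0 < s} => (((s : ℝ) ^ 2 : ℝ) : ℂ) := by
    intro s t hst
    have : (s : ℝ) ^ 2 = (t : ℝ) ^ 2 := Complex.ofReal_injective hst
    exact Subtype.ext ((pow_left_inj₀ s.2.le t.2.le two_ne_zero).1 this)
  -- Only eigenvalues of the form $s^2$ with $s>0$ contribute, so the sum over complex $\mu$ becomes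
  -- a sum over singular values.
  rw [← hinj.tsum_eq]
  · refine ENNReal.tsum_le_tsum fun s => ?_
    have hne : (((s : ℝ) ^ 2 : ℝ) : ℂ) ≠ 0 := by simpa using s.2.ne'
    have hfd : FiniteDimensional ℂ (K (((s : ℝ) ^ 2 : ℝ) : ℂ)) :=
      finiteDimensional_singularSpace hT hne
    have hli := (b (((s : ℝ) ^ 2 : ℝ) : ℂ)).orthonormal.linearIndependent
    have hfi : Finite (w (((s : ℝ) ^ 2 : ℝ) : ℂ)) := hli.finite
    have hft := Fintype.ofFinite (w (((s : ℝ) ^ 2 : ℝ) : ℂ))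
    have hcard := hli.fintype_card_le_finrank
    have he : ‖((((s : ℝ) ^ 2 : ℝ)) : ℂ)‖ₑ = ENNReal.ofReal s ^ 2 := by
      rw [← ofReal_norm, Complex.norm_real, Real.norm_of_nonneg (sq_nonneg _),
        ENNReal.ofReal_pow s.2.le]
    simp only
    rw [he, tsum_fintype, Finset.sum_const, nsmul_eq_mul, Finset.card_univ]
    gcongr
    exact hcard
  · intro μ hμ
    rw [Function.mem_support, ne_eq, ENNReal.tsum_eq_zero, not_forall] at hμ
    obtain ⟨k, hk⟩ := hμ
    have h1 := hpos ⟨μ, k⟩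
    simp only at h1
    have h2 : 0 < ‖T (v ⟨μ, k⟩)‖ := by
      refine (norm_nonneg _).lt_of_ne fun h0 => hk ?_
      rw [← h0] at h1
      simp [h1]
    exact ⟨⟨_, h2⟩, h1.symm⟩

/-- The inclusion $\ell^q\subset\ell^2$: each singular value is at most $M=\|T\|_{S_q}$, so $s^2\le
s^qM^{2-q}$, and summation gives $M^qM^{2-q}=M^2$. -/
theorem hsENorm_le_schattenENorm {q : ℝ≥0∞} (hq1 : 1 ≤ q) (hq2 : q ≤ 2) {T : H →L[ℂ] H}
    (hT : IsCompactOperator T) : hsENorm T ≤ schattenENorm q T := by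
  have hqt : q ≠ ∞ := ne_top_of_le_ne_top (by simp) hq2
  set r := q.toReal with hr
  have hr1 : 1 ≤ r := by
    simpa using ENNReal.toReal_mono hqt hq1
  have hr2 : r ≤ 2 := by
    simpa using ENNReal.toReal_mono (by simp) hq2
  set M := schattenENorm q T with hM
  have hMr : M ^ r = ∑' s : {s : ℝ // 0 < s},
      (singularMultiplicity T s : ℝ≥0∞) * ENNReal.ofReal s ^ r := by
    rw [hM, schattenENorm, if_neg hqt, ← ENNReal.rpow_mul, one_div,
      inv_mul_cancel₀ (by positivity), ENNReal.rpow_one]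
  have hle : ∀ s : {s : ℝ // 0 < s}, singularMultiplicity T s ≠ 0 → ENNReal.ofReal s ≤ M := by
    intro s hs
    rw [← ENNReal.rpow_le_rpow_iff (z := r) (by positivity), hMr]
    refine le_trans ?_ (ENNReal.le_tsum s)
    refine le_mul_of_one_le_left' ?_
    exact_mod_cast Nat.one_le_iff_ne_zero.2 hs
  rw [← ENNReal.sq_rpow_half (hsENorm T), ← ENNReal.sq_rpow_half M]
  gcongr ?_ ^ _
  refine (hsENorm_sq_le_tsum hT).trans ?_
  have hM2 : M ^ 2 = M ^ r * M ^ (2 - r) := by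
    rw [← ENNReal.rpow_add_of_nonneg _ _ (by linarith) (by linarith)]
    norm_num
  rw [hM2, hMr, ← ENNReal.tsum_mul_right]
  refine ENNReal.tsum_le_tsum fun s => ?_
  by_cases hs : singularMultiplicity T s = 0
  · simp [hs]
  rw [mul_assoc]
  gcongr
  calc ENNReal.ofReal s ^ 2 = ENNReal.ofReal s ^ r * ENNReal.ofReal s ^ (2 - r) := by
        rw [← ENNReal.rpow_add_of_nonneg _ _ (by linarith) (by linarith)]
        norm_num
    _ ≤ _ := by
        refine mul_le_mul_right ?_ _
        exact ENNReal.rpow_le_rpow (hle s hs) (by linarith)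

end HilbertSchmidt

/-! ### Plancherel's theorem on a Euclidean space. -/

section Plancherel

open scoped FourierTransform SchwartzMap ContDiff

variable {E : Type*} [NormedAddCommGroup E] [InnerProductSpace ℝ E] [FiniteDimensional ℝ E]
  [MeasurableSpace E] [BorelSpace E]

/-- The Fourier integral of an element of `L¹ ∩ L²` is its `L²` Fourier transform. -/
theorem fourier_ae_eq_Lp_fourier {h : E → ℂ} (h1 : Integrable h) (h2 : MemLp h 2) :
    𝓕 h =ᵐ[volume] (𝓕 (h2.toLp h) : Lp ℂ 2 (volume : Measure E)) := by
  have hcont : Continuous (𝓕 h) :=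
    VectorFourier.fourierIntegral_continuous Real.continuous_fourierChar continuous_inner h1
  -- Both sides are tested against smooth compactly supported functions. In each case the transform
  -- moves onto the test function: by duality of tempered distributions for the $L^2$ transform
  -- (`e1`), by Fubini for the integral (`e2`).
  refine ae_eq_of_integral_contDiff_smul_eq hcont.locallyIntegrable
    ((Lp.memLp (𝓕 (h2.toLp h) : Lp ℂ 2 (volume : Measure E))).locallyIntegrable (by norm_num)) fun g hg hgc => ?_
  have hgc' : HasCompactSupport fun x => (g x : ℂ) := hgc.comp_left Complex.ofReal_zero
  let φ : 𝓢(E, ℂ) := hgc'.toSchwartzMap (Complex.ofRealCLM.contDiff.comp hg)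
  have hφ : ∀ x, φ x = g x := fun x => rfl
  have e1 : ∫ x, g x • (𝓕 (h2.toLp h) : Lp ℂ 2 (volume : Measure E)) x = ∫ x, 𝓕 φ x * h x := by
    have := congrArg (fun T => T φ) (Lp.fourier_toTemperedDistribution_eq (h2.toLp h))
    simp only [TemperedDistribution.fourier_apply, Lp.toTemperedDistribution_apply] at this
    simp only [smul_eq_mul, hφ] at this
    simp only [Complex.real_smul]
    rw [← this]
    refine integral_congr_ae ?_
    filter_upwards [h2.coeFn_toLp] with x hx
    rw [hx]
  have e2 : ∫ x, 𝓕 φ x * h x = ∫ x, g x • 𝓕 h x := by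
    have := VectorFourier.integral_fourierIntegral_smul_eq_flip (L := innerₗ E)
      Real.continuous_fourierChar continuous_inner (φ.integrable (μ := volume)) h1
    simp only [flip_innerₗ, smul_eq_mul] at this
    simp only [Complex.real_smul]
    exact this
  rw [e1, e2]

/-- Plancherel's theorem on `L¹ ∩ L²`. -/
theorem lintegral_enorm_fourier_sq {h : E → ℂ} (h1 : Integrable h) (h2 : MemLp h 2) :
    ∫⁻ ξ, ‖𝓕 h ξ‖ₑ ^ 2 = ∫⁻ x, ‖h x‖ₑ ^ 2 := by
  have e : ∀ k : E → ℂ, (∫⁻ x, ‖k x‖ₑ ^ 2) = eLpNorm k 2 volume ^ 2 := fun k => by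
    simpa using (eLpNorm_nnreal_pow_eq_lintegral (f := k) (p := 2) (μ := volume)
      two_ne_zero).symm
  rw [e, e, eLpNorm_congr_ae (fourier_ae_eq_Lp_fourier h1 h2), ← Lp.enorm_def,
    ← eLpNorm_congr_ae h2.coeFn_toLp, ← Lp.enorm_def, ← ofReal_norm, ← ofReal_norm,
    Lp.norm_fourier_eq]

end Plancherel

/-! ### Plancherel's theorem for the Minkowski pairing. -/

namespace AffPoincare

/-- The Fourier integral on the plane with the Minkowski pairing. -/
def minkFourier (h : ℝ × ℝ → ℂ) (x : ℝ × ℝ) : ℂ := ∫ b, h b * Complex.exp (Complex.I * mink x b)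

-- With $L=\mathrm{diag}(-1,1)/2\pi$ one has $-2\pi\langle b,Lx\rangle=\langle x;b\rangle$, so this
-- transform is the usual one composed with $L$; the constant is $|\det L|^{-1}$. The passage
-- through `WithLp 2` is needed because `ℝ × ℝ` carries the sup norm.
open scoped FourierTransform in
theorem lintegral_enorm_minkFourier_sq {h : ℝ × ℝ → ℂ} (h1 : Integrable h) (h2 : MemLp h 2) :
    ∫⁻ x, ‖minkFourier h x‖ₑ ^ 2 = ENNReal.ofReal (4 * Real.pi ^ 2) * ∫⁻ b, ‖h b‖ₑ ^ 2 := by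
  have hpi := Real.pi_pos
  have mp := WithLp.volume_preserving_ofLp ℝ ℝ
  have me : MeasurableEmbedding (WithLp.ofLp : WithLp 2 (ℝ × ℝ) → ℝ × ℝ) :=
    (MeasurableEquiv.toLp 2 (ℝ × ℝ)).symm.measurableEmbedding
  have mp' := WithLp.volume_preserving_toLp ℝ ℝ
  let h' : WithLp 2 (ℝ × ℝ) → ℂ := fun b => h (WithLp.ofLp b)
  have h1' : Integrable h' := mp.integrable_comp_of_integrable h1
  have h2' : MemLp h' 2 := h2.comp_measurePreserving mp
  have hcont : Continuous (𝓕 h') :=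
    VectorFourier.fourierIntegral_continuous Real.continuous_fourierChar continuous_inner h1'
  let M : Matrix (Fin 2) (Fin 2) ℝ := !![-(2 * Real.pi)⁻¹, 0; 0, (2 * Real.pi)⁻¹]
  let L := Matrix.toLin (Module.Basis.finTwoProd ℝ) (Module.Basis.finTwoProd ℝ) M
  have hL : ∀ x, L x = (-(2 * Real.pi)⁻¹ * x.1, (2 * Real.pi)⁻¹ * x.2) := fun x => by
    simp [L, M, Matrix.toLin_finTwoProd_apply]
  have hdet : LinearMap.det L = -(4 * Real.pi ^ 2)⁻¹ := by
    rw [LinearMap.det_toLin, Matrix.det_fin_two_of]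
    field_simp
    ring
  have hF : ∀ x, minkFourier h x = 𝓕 h' (WithLp.toLp 2 (L x)) := by
    intro x
    rw [Real.fourier_eq', minkFourier, ← mp.integral_comp me]
    refine integral_congr_ae (Eventually.of_forall fun b => ?_)
    simp only [h', smul_eq_mul]
    rw [mul_comm, hL]
    congr 2
    simp only [WithLp.prod_inner_apply, mink]
    simp
    field_simp
    ring
  simp_rw [hF]
  have hmeas : Measurable fun y : ℝ × ℝ => ‖𝓕 h' (WithLp.toLp 2 y)‖ₑ ^ 2 :=
    ((hcont.measurable.comp mp'.measurable).enorm.pow_const 2)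
  have hLm : Measurable L := (LinearMap.continuous_of_finiteDimensional L).measurable
  rw [← lintegral_map hmeas hLm, Measure.map_linearMap_addHaar_eq_smul_addHaar _
    (by rw [hdet]; exact neg_ne_zero.2 (by positivity)), hdet, lintegral_smul_measure,
    ← (mp.lintegral_comp hmeas)]
  simp only [WithLp.toLp_ofLp]
  rw [lintegral_enorm_fourier_sq h1' h2', smul_eq_mul]
  have e : |(-(4 * Real.pi ^ 2)⁻¹)⁻¹| = 4 * Real.pi ^ 2 := by
    rw [inv_neg, inv_inv, abs_neg, abs_of_pos (by positivity)]
  rw [e]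
  congr 1
  exact (mp.lintegral_comp_emb me fun b => ‖h b‖ₑ ^ 2)

end AffPoincare

namespace AffPoincare

/-! ### Coordinates on the group -/

/-- The group element with given coordinates, the identity if the dilation is not positive. -/
def ofCoords (c : (ℝ × ℝ) × ℝ × ℝ) : AffPoincare :=
  if h : 0 < c.2.1 then ⟨c.1, c.2.1, c.2.2, h⟩ else 1

theorem ofCoords_of_pos {c : (ℝ × ℝ) × ℝ × ℝ} (h : 0 < c.2.1) :
    ofCoords c = ⟨c.1, c.2.1, c.2.2, h⟩ := dif_pos h

theorem ofCoords_coords (g : AffPoincare) : ofCoords (coords g) = g :=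
  ofCoords_of_pos g.a_pos

theorem measurable_ofCoords : Measurable ofCoords := by
  refine measurable_comap_iff.2 ?_
  have : coords ∘ ofCoords = fun c => if 0 < c.2.1 then c else coords 1 := by
    funext c
    by_cases h : 0 < c.2.1
    · simp [ofCoords_of_pos h, coords, h]
    · simp [ofCoords, h]
  rw [this]
  exact Measurable.ite (measurableSet_lt measurable_const (by fun_prop)) measurable_id
    measurable_const

theorem measurable_coords : Measurable coords := measurableEmbedding_coords.measurable

/-- The parameters `(a, v)` with `a > 0`. -/
def halfPlane : Set (ℝ × ℝ) := {s | 0 < s.1}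

theorem measurableSet_halfPlane : MeasurableSet halfPlane :=
  measurableSet_lt measurable_const measurable_fst

/-- The measure `a⁻³ da dv`. -/
def scaleMeasure : Measure (ℝ × ℝ) :=
  (volume.restrict halfPlane).withDensity fun s => ENNReal.ofReal (1 / s.1 ^ 3)

instance : SigmaFinite scaleMeasure :=
  SigmaFinite.withDensity_of_ne_top (Eventually.of_forall fun _ => ENNReal.ofReal_ne_top)

theorem ae_scaleMeasure_pos : ∀ᵐ s ∂scaleMeasure, 0 < s.1 :=
  (withDensity_absolutelyContinuous _ _).ae_le (ae_restrict_mem measurableSet_halfPlane)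

theorem range_coords : Set.range coords = Set.univ ×ˢ halfPlane := by
  ext c
  constructor
  · rintro ⟨g, rfl⟩
    exact ⟨trivial, g.a_pos⟩
  · intro h
    exact ⟨⟨c.1, c.2.1, c.2.2, h.2⟩, rfl⟩

/-- The product form lets Fubini separate the translation variable from $(a,v)$. -/
theorem map_coords_haar : Measure.map coords haar = volume.prod scaleMeasure := by
  have hw : Measurable fun s : ℝ × ℝ => ENNReal.ofReal (1 / s.1 ^ 3) := by fun_prop
  rw [scaleMeasure, prod_withDensity_right hw]
  have e : (volume : Measure (ℝ × ℝ)).prod (volume.restrict halfPlane)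
      = Measure.map coords (Measure.comap coords volume) := by
    rw [measurableEmbedding_coords.map_comap, range_coords,
      Measure.volume_eq_prod (ℝ × ℝ) (ℝ × ℝ), ← Measure.prod_restrict, Measure.restrict_univ]
  rw [e]
  refine Measure.ext fun t ht => ?_
  rw [Measure.map_apply measurable_coords ht, haar, withDensity_apply _ (measurable_coords ht),
    withDensity_apply _ ht,
    setLIntegral_map (f := fun c : (ℝ × ℝ) × ℝ × ℝ => ENNReal.ofReal (1 / c.2.1 ^ 3)) ht
      (hw.comp measurable_snd) measurable_coords]
  rfl

theorem measurePreserving_ofCoords :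
    MeasurePreserving ofCoords (volume.prod scaleMeasure) haar := by
  refine ⟨measurable_ofCoords, ?_⟩
  rw [← map_coords_haar, Measure.map_map measurable_ofCoords measurable_coords]
  have : ofCoords ∘ coords = id := funext ofCoords_coords
  rw [this, Measure.map_id]

theorem measurePreserving_coords :
    MeasurePreserving coords haar (volume.prod scaleMeasure) :=
  ⟨measurable_coords, map_coords_haar⟩

instance : SigmaFinite haar :=
  measurePreserving_coords.sigmaFinite

/-! ### The orbit maps -/

/-- The orbit map `(a, v) ↦ a Λ_{-v} x`. -/
def orbitMap (x s : ℝ × ℝ) : ℝ × ℝ := s.1 • boost (-s.2) x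

theorem measurable_orbitMap_uncurry :
    Measurable fun z : (ℝ × ℝ) × ℝ × ℝ => orbitMap z.1 z.2 := by
  unfold orbitMap boost
  fun_prop

theorem measurable_orbitMap (x : ℝ × ℝ) : Measurable (orbitMap x) :=
  measurable_orbitMap_uncurry.comp (measurable_const.prodMk measurable_id)

/-- The light-cone coordinates $x_1\pm x_2$ diagonalize the hyperbolic rotations, which reduces
bijectivity of the orbit map to solving for $ae^{-v}$ and $ae^{v}$. -/
theorem orbitMap_add (x s : ℝ × ℝ) :
    (orbitMap x s).1 + (orbitMap x s).2 = s.1 * Real.exp (-s.2) * (x.1 + x.2) := by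
  simp only [orbitMap, boost, Prod.smul_mk, smul_eq_mul]
  rw [← Real.cosh_add_sinh (-s.2)]
  ring

theorem orbitMap_sub (x s : ℝ × ℝ) :
    (orbitMap x s).1 - (orbitMap x s).2 = s.1 * Real.exp s.2 * (x.1 - x.2) := by
  simp only [orbitMap, boost, Prod.smul_mk, smul_eq_mul]
  rw [← Real.cosh_add_sinh s.2, Real.cosh_neg, Real.sinh_neg]
  ring

theorem mink_self_ne_zero {i j : Fin 2} {x : ℝ × ℝ} (hx : x ∈ cone i j) : mink x x ≠ 0 := by
  fin_cases i <;> fin_cases j <;> simp only [cone, Set.mem_ofPred_eq] at hx <;> simp only [mink] <;> intro h <;> nlinarith [hx.1]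

/-- On each cone the two light-cone coordinates have constant nonzero signs. -/
theorem mul_light_pos {i j : Fin 2} {x y : ℝ × ℝ} (hx : x ∈ cone i j) (hy : y ∈ cone i j) :
    0 < (x.1 + x.2) * (y.1 + y.2) ∧ 0 < (x.1 - x.2) * (y.1 - y.2) := by
  fin_cases i <;> fin_cases j <;> simp only [cone, Set.mem_ofPred_eq] at hx hy <;> obtain ⟨hx1, hx2⟩ := hx <;> obtain ⟨hy1, hy2⟩ := hy <;>
    have hx1 := abs_lt.1 (sq_lt_sq.1 hx1) <;> have hy1 := abs_lt.1 (sq_lt_sq.1 hy1)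
  · rw [abs_of_pos hx2] at hx1
    rw [abs_of_pos hy2] at hy1
    exact ⟨mul_pos (by linarith) (by linarith), mul_pos (by linarith) (by linarith)⟩
  · rw [abs_of_pos hx2] at hx1
    rw [abs_of_pos hy2] at hy1
    exact ⟨mul_pos (by linarith) (by linarith),
      mul_pos_of_neg_of_neg (by linarith) (by linarith)⟩
  · rw [abs_of_neg (neg_pos.1 hx2)] at hx1
    rw [abs_of_neg (neg_pos.1 hy2)] at hy1
    exact ⟨mul_pos_of_neg_of_neg (by linarith) (by linarith),
      mul_pos_of_neg_of_neg (by linarith) (by linarith)⟩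
  · rw [abs_of_neg (neg_pos.1 hx2)] at hx1
    rw [abs_of_neg (neg_pos.1 hy2)] at hy1
    exact ⟨mul_pos_of_neg_of_neg (by linarith) (by linarith),
      mul_pos (by linarith) (by linarith)⟩

theorem orbitMap_mem_cone {i j : Fin 2} {x s : ℝ × ℝ} (hs : 0 < s.1) :
    orbitMap x s ∈ cone i j ↔ x ∈ cone i j := by
  have := dil_preimage_cone ⟨0, s.1, s.2, hs⟩ i j
  exact Set.ext_iff.1 this x

theorem light_ne_zero {i j : Fin 2} {x : ℝ × ℝ} (hx : x ∈ cone i j) :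
    x.1 + x.2 ≠ 0 ∧ x.1 - x.2 ≠ 0 := by
  obtain ⟨h1, h2⟩ := mul_light_pos hx hx
  exact ⟨(mul_self_pos.1 h1), (mul_self_pos.1 h2)⟩

theorem injOn_orbitMap {i j : Fin 2} {x : ℝ × ℝ} (hx : x ∈ cone i j) :
    Set.InjOn (orbitMap x) halfPlane := by
  obtain ⟨hp, hm⟩ := light_ne_zero hx
  intro s hs t ht hst
  have h1 : s.1 * Real.exp (-s.2) = t.1 * Real.exp (-t.2) := by
    refine mul_right_cancel₀ hp ?_
    rw [← orbitMap_add, ← orbitMap_add, hst]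
  have h2 : s.1 * Real.exp s.2 = t.1 * Real.exp t.2 := by
    refine mul_right_cancel₀ hm ?_
    rw [← orbitMap_sub, ← orbitMap_sub, hst]
  have e : ∀ v, Real.exp (-v) * Real.exp v = 1 := fun v => by
    rw [← Real.exp_add, neg_add_cancel, Real.exp_zero]
  -- The product of $ae^{-v}$ and $ae^{v}$ is $a^2$.
  have h3 : s.1 ^ 2 = t.1 ^ 2 := by
    linear_combination s.1 * Real.exp s.2 * h1 + t.1 * Real.exp (-t.2) * h2
      - s.1 ^ 2 * e s.2 + t.1 ^ 2 * e t.2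
  have h4 : s.1 = t.1 := (pow_left_inj₀ (le_of_lt hs) (le_of_lt ht) two_ne_zero).1 h3
  rw [h4] at h2
  exact Prod.ext h4 (Real.exp_injective (mul_left_cancel₀ (ne_of_gt ht) h2))

theorem image_orbitMap {i j : Fin 2} {x : ℝ × ℝ} (hx : x ∈ cone i j) :
    orbitMap x '' halfPlane = cone i j := by
  refine Set.Subset.antisymm ?_ fun y hy => ?_
  · rintro _ ⟨s, hs, rfl⟩
    exact (orbitMap_mem_cone hs).2 hx
  · obtain ⟨hp, hm⟩ := light_ne_zero hx
    obtain ⟨h1, h2⟩ := mul_light_pos hx hy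
    have hP : 0 < (y.1 + y.2) / (x.1 + x.2) := by
      rw [div_eq_mul_inv, ← mul_pos_iff_of_pos_right (mul_self_pos.2 hp)]
      calc 0 < _ := h1
        _ = _ := by field_simp
    have hM : 0 < (y.1 - y.2) / (x.1 - x.2) := by
      rw [div_eq_mul_inv, ← mul_pos_iff_of_pos_right (mul_self_pos.2 hm)]
      calc 0 < _ := h2
        _ = _ := by field_simp
    set α := Real.log ((y.1 + y.2) / (x.1 + x.2)) with hα
    set β := Real.log ((y.1 - y.2) / (x.1 - x.2)) with hβ
    -- The solution of $ae^{-v}=e^{\alpha}$, $ae^{v}=e^{\beta}$.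
    refine ⟨(Real.exp ((α + β) / 2), (β - α) / 2), Real.exp_pos _, ?_⟩
    have k1 := orbitMap_add x (Real.exp ((α + β) / 2), (β - α) / 2)
    have k2 := orbitMap_sub x (Real.exp ((α + β) / 2), (β - α) / 2)
    simp only at k1 k2
    rw [← Real.exp_add, show (α + β) / 2 + -((β - α) / 2) = α by ring, hα, Real.exp_log hP,
      div_mul_cancel₀ _ hp] at k1
    rw [← Real.exp_add, show (α + β) / 2 + (β - α) / 2 = β by ring, hβ, Real.exp_log hM,
      div_mul_cancel₀ _ hm] at k2
    ext
    · linarith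
    · linarith

/-- The derivative of the orbit map. -/
def fderivOrbitMap (x s : ℝ × ℝ) : ℝ × ℝ →L[ℝ] ℝ × ℝ :=
  (Matrix.toLin (.finTwoProd ℝ) (.finTwoProd ℝ)
    !![Real.cosh s.2 * x.1 - Real.sinh s.2 * x.2, s.1 * (Real.sinh s.2 * x.1 - Real.cosh s.2 * x.2);
      Real.cosh s.2 * x.2 - Real.sinh s.2 * x.1,
      s.1 * (Real.sinh s.2 * x.2 - Real.cosh s.2 * x.1)]).toContinuousLinearMap

theorem hasFDerivAt_orbitMap (x s : ℝ × ℝ) :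
    HasFDerivAt (orbitMap x) (fderivOrbitMap x s) s := by
  have hc := (Real.hasDerivAt_cosh s.2).comp_hasFDerivAt s
    (hasFDerivAt_snd (𝕜 := ℝ) (p := s))
  have hs := (Real.hasDerivAt_sinh s.2).comp_hasFDerivAt s
    (hasFDerivAt_snd (𝕜 := ℝ) (p := s))
  have h : HasFDerivAt (fun s : ℝ × ℝ => (s.1 * (Real.cosh s.2 * x.1 - Real.sinh s.2 * x.2),
      s.1 * (Real.cosh s.2 * x.2 - Real.sinh s.2 * x.1))) (fderivOrbitMap x s) s := by
    unfold fderivOrbitMap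
    rw [Matrix.toLin_finTwoProd_toContinuousLinearMap]
    convert! HasFDerivAt.prodMk (𝕜 := ℝ)
      (hasFDerivAt_fst.mul ((hc.mul_const x.1).sub (hs.mul_const x.2)))
      (hasFDerivAt_fst.mul ((hc.mul_const x.2).sub (hs.mul_const x.1))) using 1
    ext <;> simp <;> ring_nf <;> simp
  convert! h using 1
  funext s
  simp only [orbitMap, boost, Prod.smul_mk, smul_eq_mul, Real.cosh_neg, Real.sinh_neg,
    Prod.mk.injEq]
  constructor <;> ring

theorem det_fderivOrbitMap (x s : ℝ × ℝ) :
    (fderivOrbitMap x s).det = -(s.1 * mink x x) := by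
  unfold fderivOrbitMap
  simp only [LinearMap.det_toContinuousLinearMap, LinearMap.det_toLin, Matrix.det_fin_two_of, mink]
  linear_combination s.1 * (x.2 ^ 2 - x.1 ^ 2) * Real.cosh_sq s.2

/-- The measure `a |⟨x;x⟩| da dv`. -/
def orbitMeasure (x : ℝ × ℝ) : Measure (ℝ × ℝ) :=
  (volume.restrict halfPlane).withDensity fun s => ENNReal.ofReal (s.1 * |mink x x|)

/-- The orbit map of a point of a cone identifies the group of dilations and hyperbolic rotations
with this cone. -/
theorem measurePreserving_orbitMap {i j : Fin 2} {x : ℝ × ℝ} (hx : x ∈ cone i j) :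
    MeasurePreserving (orbitMap x) (orbitMeasure x) (coneMeasure i j) := by
  refine ⟨measurable_orbitMap x, Measure.ext fun t ht => ?_⟩
  -- Change of variables for the indicator function of `t`; the density of `orbitMeasure` is the
  -- absolute Jacobian.
  have h := lintegral_image_eq_lintegral_abs_det_fderiv_mul volume measurableSet_halfPlane
    (fun s _ => (hasFDerivAt_orbitMap x s).hasFDerivWithinAt) (injOn_orbitMap hx)
    (t.indicator 1)
  rw [image_orbitMap hx, lintegral_indicator_one ht] at h
  rw [Measure.map_apply (measurable_orbitMap x) ht, coneMeasure, h, orbitMeasure,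
    withDensity_apply _ (measurable_orbitMap x ht),
    ← lintegral_indicator (measurable_orbitMap x ht)]
  refine setLIntegral_congr_fun measurableSet_halfPlane fun s hs => ?_
  simp only [det_fderivOrbitMap, abs_neg, abs_mul, abs_of_pos (show 0 < s.1 from hs)]
  by_cases hst : orbitMap x s ∈ t
  · rw [Set.indicator_of_mem (show s ∈ orbitMap x ⁻¹' t from hst), Set.indicator_of_mem hst]
    simp
  · rw [Set.indicator_of_notMem (show s ∉ orbitMap x ⁻¹' t from hst),
      Set.indicator_of_notMem hst]
    simp

end AffPoincare

/-! ### The Fourier transform as a Hilbert-Schmidt integral operator. -/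

theorem lintegral_enorm_sq {α : Type*} [MeasurableSpace α] (μ : Measure α) (f : α → ℂ) :
    ∫⁻ x, ‖f x‖ₑ ^ 2 ∂μ = eLpNorm f 2 μ ^ 2 := by
  simpa using (eLpNorm_nnreal_pow_eq_lintegral (f := f) (p := 2) (μ := μ) two_ne_zero).symm

namespace AffPoincare

/-- The Fourier transform of a function on the group in the translation variable. -/
def partialFourier (f : AffPoincare → ℂ) (x s : ℝ × ℝ) : ℂ :=
  minkFourier (fun b => f (ofCoords (b, s))) x

theorem measurable_partialFourier {f : AffPoincare → ℂ} (hf : Measurable f) :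
    Measurable fun z : (ℝ × ℝ) × (ℝ × ℝ) => partialFourier f z.1 z.2 := by
  have h : Measurable fun w : ((ℝ × ℝ) × (ℝ × ℝ)) × (ℝ × ℝ) =>
      f (ofCoords (w.2, w.1.2)) * Complex.exp (Complex.I * mink w.1.1 w.2) := by
    refine (hf.comp (measurable_ofCoords.comp (by fun_prop))).mul ?_
    unfold mink
    fun_prop
  exact h.stronglyMeasurable.integral_prod_right'.measurable

/-- The square of the Hilbert-Schmidt norm density of the Fourier transform. -/
def fourierDensity (f : AffPoincare → ℂ) (x : ℝ × ℝ) : ℝ≥0∞ :=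
  ENNReal.ofReal ((4 * Real.pi ^ 2)⁻¹) * ∫⁻ s, ‖partialFourier f x s‖ₑ ^ 2 ∂scaleMeasure

/-- Tonelli, then Plancherel in $b$ for almost every $(a,v)$: almost every slice of $f$ lies in
$L^1\cap L^2$. The factor $(4\pi^2)^{-1}$ removes the Plancherel constant. -/
theorem lintegral_fourierDensity {f : AffPoincare → ℂ} (hf : Measurable f)
    (h1 : Integrable f haar) (h2 : MemLp f 2 haar) :
    ∫⁻ x, fourierDensity f x = eLpNorm f 2 haar ^ 2 := by
  have hpi := Real.pi_pos
  have hm := (measurable_partialFourier hf).enorm.pow_const 2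
  have hu : Measurable fun c => f (ofCoords c) := hf.comp measurable_ofCoords
  have h1' : Integrable (fun c => f (ofCoords c)) (volume.prod scaleMeasure) :=
    measurePreserving_ofCoords.integrable_comp_of_integrable h1
  have h2' : ∫⁻ c, ‖f (ofCoords c)‖ₑ ^ 2 ∂(volume.prod scaleMeasure) = eLpNorm f 2 haar ^ 2 := by
    rw [← lintegral_enorm_sq]
    exact measurePreserving_ofCoords.lintegral_comp (hf.enorm.pow_const 2)
  rw [lintegral_prod_symm _ (hu.enorm.pow_const 2).aemeasurable] at h2'
  have hfin : ∀ᵐ s ∂scaleMeasure, ∫⁻ b, ‖f (ofCoords (b, s))‖ₑ ^ 2 < ∞ := by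
    refine ae_lt_top (hu.enorm.pow_const 2).lintegral_prod_left' ?_
    rw [h2']
    exact ENNReal.pow_ne_top h2.2.ne
  unfold fourierDensity
  rw [lintegral_const_mul _ hm.lintegral_prod_right', lintegral_lintegral_swap hm.aemeasurable,
    ← h2', ← lintegral_const_mul _ (hm.lintegral_prod_left')]
  refine lintegral_congr_ae ?_
  filter_upwards [h1'.prod_left_ae, hfin] with s hs1 hs2
  have hs3 : MemLp (fun b => f (ofCoords (b, s))) 2 := by
    refine ⟨hs1.1, ?_⟩
    rw [lintegral_enorm_sq] at hs2
    exact (ENNReal.pow_lt_top_iff.1 hs2).resolve_right two_ne_zero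
  unfold partialFourier
  rw [lintegral_enorm_minkFourier_sq hs1 hs3, ← mul_assoc, ← ENNReal.ofReal_mul (by positivity),
    inv_mul_cancel₀ (by positivity), ENNReal.ofReal_one, one_mul]

/-- The Fourier transform of `f`, applied to `φ`, as a function on the cone. -/
def fourierFun (f : AffPoincare → ℂ) (φ : ℝ × ℝ → ℂ) (x : ℝ × ℝ) : ℂ :=
  ∫ s, partialFourier f x s * (dufloWeight x * s.1 ^ 2 : ℝ) * φ (orbitMap x s) ∂scaleMeasure

theorem measurable_dufloWeight : Measurable dufloWeight := by
  unfold dufloWeight mink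
  fun_prop

theorem measurable_fourierFun {f : AffPoincare → ℂ} (hf : Measurable f) {φ : ℝ × ℝ → ℂ}
    (hφ : Measurable φ) : Measurable (fourierFun f φ) := by
  have h : Measurable fun z : (ℝ × ℝ) × (ℝ × ℝ) =>
      partialFourier f z.1 z.2 * (dufloWeight z.1 * z.2.1 ^ 2 : ℝ) * φ (orbitMap z.1 z.2) := by
    refine ((measurable_partialFourier hf).mul ?_).mul (hφ.comp measurable_orbitMap_uncurry)
    have := measurable_dufloWeight
    fun_prop
  exact h.stronglyMeasurable.integral_prod_right'.measurable

theorem sq_dufloWeight (x : ℝ × ℝ) : dufloWeight x ^ 2 = (4 * Real.pi ^ 2)⁻¹ * |mink x x| := by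
  have := Real.pi_pos
  rw [dufloWeight, mul_pow, Real.sq_sqrt (abs_nonneg _)]
  field_simp
  ring

/-- At a point of finite density, the Fourier transform is given by a square integrable kernel. -/
theorem exists_kernel {f : AffPoincare → ℂ} (hf : Measurable f) {i j : Fin 2} {x : ℝ × ℝ}
    (hx : x ∈ cone i j) (hfin : fourierDensity f x < ∞) :
    ∃ ψ : ConeL2 i j, ‖ψ‖ₑ ^ 2 ≤ fourierDensity f x ∧
      ∀ φ : ConeL2 i j, fourierFun f φ x = inner ℂ ψ φ := by
  have hpi := Real.pi_pos
  have hmx : 0 < |mink x x| := abs_pos.2 (mink_self_ne_zero hx)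
  have mp := measurePreserving_orbitMap hx
  -- Pullback along the orbit map, an isometry of the cone space into the $L^2$ space of
  -- `orbitMeasure x`.
  let J := Lp.compMeasurePreservingₗᵢ (E := ℂ) (p := 2) ℂ (orbitMap x) mp
  -- The integrand weight $w(x)a^2\cdot a^{-3}$ divided by the orbit density $a|\langle
  -- x;x\rangle|$; the conjugate is there because the inner product is conjugate-linear on the left.
  let κ : ℝ × ℝ → ℂ := fun s =>
    starRingEnd ℂ (partialFourier f x s * (dufloWeight x * (s.1 ^ 2 * |mink x x|)⁻¹ : ℝ))
  have hpm : Measurable fun s => partialFourier f x s :=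
    (measurable_partialFourier hf).comp (measurable_const.prodMk measurable_id)
  have hκm : Measurable κ := by
    refine Complex.continuous_conj.measurable.comp (hpm.mul ?_)
    fun_prop
  have hκ : ∫⁻ s, ‖κ s‖ₑ ^ 2 ∂orbitMeasure x = fourierDensity f x := by
    rw [orbitMeasure, lintegral_withDensity_eq_lintegral_mul _ (by fun_prop)
      (hκm.enorm.pow_const 2), fourierDensity, scaleMeasure,
      lintegral_withDensity_eq_lintegral_mul _ (by fun_prop) (hpm.enorm.pow_const 2),
      ← lintegral_const_mul _ (by fun_prop)]
    refine setLIntegral_congr_fun measurableSet_halfPlane fun s hs => ?_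
    have hs : 0 < s.1 := hs
    simp only [Pi.mul_apply, κ, RCLike.enorm_conj, enorm_mul, mul_pow]
    rw [← ofReal_norm ((_ : ℝ) : ℂ), Complex.norm_real, Real.norm_eq_abs,
      ← ENNReal.ofReal_pow (abs_nonneg _), sq_abs, mul_left_comm, mul_comm (‖_‖ₑ ^ 2), ← mul_assoc,
      ← ENNReal.ofReal_mul (by positivity), ← ENNReal.ofReal_mul (by positivity)]
    congr 2
    rw [mul_pow, sq_dufloWeight]
    field_simp
  have hκL : MemLp κ 2 (orbitMeasure x) := by
    refine ⟨hκm.aestronglyMeasurable, ?_⟩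
    rw [← hκ, lintegral_enorm_sq] at hfin
    exact (ENNReal.pow_lt_top_iff.1 hfin).resolve_right two_ne_zero
  -- Pushing the kernel to the cone by $J^*$ avoids inverting the orbit map; contractivity of $J^*$
  -- suffices.
  refine ⟨ContinuousLinearMap.adjoint J.toContinuousLinearMap (hκL.toLp κ), ?_, fun φ => ?_⟩
  · rw [← hκ, lintegral_enorm_sq, ← eLpNorm_congr_ae hκL.coeFn_toLp, ← Lp.enorm_def]
    gcongr
    refine (ContinuousLinearMap.le_opENorm _ _).trans ?_
    refine mul_le_of_le_one_left' ?_
    rw [← ofReal_norm, LinearIsometryEquiv.norm_map]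
    exact ENNReal.ofReal_le_one.2 J.norm_toContinuousLinearMap_le
  · rw [ContinuousLinearMap.adjoint_inner_left, L2.inner_def]
    have e : (fun s => inner ℂ ((hκL.toLp κ) s) ((J.toContinuousLinearMap φ) s))
        =ᵐ[orbitMeasure x] fun s => starRingEnd ℂ (κ s) * φ (orbitMap x s) := by
      filter_upwards [hκL.coeFn_toLp, Lp.coeFn_compMeasurePreserving φ mp] with s h1 h2
      have h3 : (J.toContinuousLinearMap φ) s = φ (orbitMap x s) := h2
      rw [h1, h3, RCLike.inner_apply, mul_comm]
    rw [integral_congr_ae e, orbitMeasure, integral_withDensity_eq_integral_toReal_smul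
      (by fun_prop) (Eventually.of_forall fun _ => ENNReal.ofReal_lt_top), fourierFun, scaleMeasure,
      integral_withDensity_eq_integral_toReal_smul (by fun_prop)
      (Eventually.of_forall fun _ => ENNReal.ofReal_lt_top)]
    refine setIntegral_congr_fun measurableSet_halfPlane fun s hs => ?_
    have hs : 0 < s.1 := hs
    have hs' : (s.1 : ℂ) ≠ 0 := by exact_mod_cast hs.ne'
    have hm' : ((|mink x x| : ℝ) : ℂ) ≠ 0 := by exact_mod_cast hmx.ne'
    simp only [κ, Complex.conj_conj, Complex.real_smul]
    rw [ENNReal.toReal_ofReal (by positivity), ENNReal.toReal_ofReal (by positivity)]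
    push_cast
    field_simp

theorem ae_fourierDensity_lt_top {f : AffPoincare → ℂ} (hf : Measurable f)
    (h1 : Integrable f haar) (h2 : MemLp f 2 haar) (i j : Fin 2) :
    ∀ᵐ x ∂coneMeasure i j, x ∈ cone i j ∧ fourierDensity f x < ∞ := by
  have hm : Measurable (fourierDensity f) :=
    ((measurable_partialFourier hf).enorm.pow_const 2).lintegral_prod_right'.const_mul _
  have := ae_lt_top hm (by
    rw [lintegral_fourierDensity hf h1 h2]
    exact ENNReal.pow_ne_top h2.2.ne)
  filter_upwards [ae_restrict_mem (measurableSet_cone i j), ae_restrict_of_ae this] with x hx hx'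
  exact ⟨hx, hx'⟩

theorem setLIntegral_fourierDensity_le {f : AffPoincare → ℂ} (hf : Measurable f)
    (h1 : Integrable f haar) (h2 : MemLp f 2 haar) (i j : Fin 2) :
    ∫⁻ x, fourierDensity f x ∂coneMeasure i j ≤ eLpNorm f 2 haar ^ 2 := by
  rw [← lintegral_fourierDensity hf h1 h2]
  exact lintegral_mono' Measure.restrict_le_self le_rfl

theorem eLpNorm_fourierFun_le {f : AffPoincare → ℂ} (hf : Measurable f)
    (h1 : Integrable f haar) (h2 : MemLp f 2 haar) {i j : Fin 2} (φ : ConeL2 i j) :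
    eLpNorm (fourierFun f φ) 2 (coneMeasure i j) ≤ eLpNorm f 2 haar * ‖φ‖ₑ := by
  rw [← ENNReal.pow_le_pow_left_iff two_ne_zero, ← lintegral_enorm_sq, mul_pow]
  calc ∫⁻ x, ‖fourierFun f φ x‖ₑ ^ 2 ∂coneMeasure i j
      ≤ ∫⁻ x, fourierDensity f x * ‖φ‖ₑ ^ 2 ∂coneMeasure i j := by
        refine lintegral_mono_ae ?_
        filter_upwards [ae_fourierDensity_lt_top hf h1 h2 i j] with x hx
        obtain ⟨ψ, hψ, hφ⟩ := exists_kernel hf hx.1 hx.2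
        rw [hφ]
        refine le_trans ?_ (mul_le_mul_left hψ _)
        rw [← mul_pow]
        gcongr
        rw [← ofReal_norm, ← ofReal_norm, ← ofReal_norm, ← ENNReal.ofReal_mul (norm_nonneg _)]
        exact ENNReal.ofReal_le_ofReal (norm_inner_le_norm _ _)
    _ = (∫⁻ x, fourierDensity f x ∂coneMeasure i j) * ‖φ‖ₑ ^ 2 :=
        lintegral_mul_const' _ _ (by finiteness)
    _ ≤ _ := by
        gcongr
        exact setLIntegral_fourierDensity_le hf h1 h2 i j

theorem memLp_fourierFun {f : AffPoincare → ℂ} (hf : Measurable f)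
    (h1 : Integrable f haar) (h2 : MemLp f 2 haar) {i j : Fin 2} (φ : ConeL2 i j) :
    MemLp (fourierFun f φ) 2 (coneMeasure i j) :=
  ⟨(measurable_fourierFun hf (Lp.stronglyMeasurable φ).measurable).aestronglyMeasurable,
    (eLpNorm_fourierFun_le hf h1 h2 φ).trans_lt (ENNReal.mul_lt_top h2.2 enorm_lt_top)⟩

/-- The Fourier transform of an element of `L¹ ∩ L²` is a Hilbert-Schmidt operator. -/
theorem exists_fourierOp {f : AffPoincare → ℂ} (hf : Measurable f)
    (h1 : Integrable f haar) (h2 : MemLp f 2 haar) (i j : Fin 2) :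
    ∃ A : ConeL2 i j →L[ℂ] ConeL2 i j,
      (∀ φ : ConeL2 i j, A φ =ᵐ[coneMeasure i j] fourierFun f φ) ∧
      hsENorm A ≤ eLpNorm f 2 haar := by
  let A : ConeL2 i j →L[ℂ] ConeL2 i j := LinearMap.mkContinuous
    { toFun := fun φ => (memLp_fourierFun hf h1 h2 φ).toLp _
      map_add' := by
        intro φ ψ
        rw [← MemLp.toLp_add]
        apply MemLp.toLp_congr
        filter_upwards [ae_fourierDensity_lt_top hf h1 h2 i j] with x hx
        obtain ⟨χ, -, hχ⟩ := exists_kernel hf hx.1 hx.2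
        simp only [Pi.add_apply, hχ, inner_add_right]
      map_smul' := by
        intro c φ
        rw [RingHom.id_apply, ← MemLp.toLp_const_smul]
        apply MemLp.toLp_congr
        filter_upwards [ae_fourierDensity_lt_top hf h1 h2 i j] with x hx
        obtain ⟨χ, -, hχ⟩ := exists_kernel hf hx.1 hx.2
        simp only [Pi.smul_apply, hχ, inner_smul_right, smul_eq_mul] }
    (eLpNorm f 2 haar).toReal (by
      intro φ
      simp only [LinearMap.coe_mk, AddHom.coe_mk, Lp.norm_toLp]
      have := ENNReal.toReal_mono (by finiteness [h2.2.ne]) (eLpNorm_fourierFun_le hf h1 h2 φ)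
      rwa [ENNReal.toReal_mul, toReal_enorm] at this)
  have hA : ∀ φ : ConeL2 i j, A φ =ᵐ[coneMeasure i j] fourierFun f φ :=
    fun φ => (memLp_fourierFun hf h1 h2 φ).coeFn_toLp
  refine ⟨A, hA, ?_⟩
  obtain ⟨b, -⟩ := (exists_hilbertBasis ℂ (ConeL2 i j)).choose_spec
  -- Finite partial sums commute with the integral. At almost every $x$ the values $(Ab_k)(x)$ are
  -- the coefficients of one kernel vector, so Parseval bounds their squares by the density.
  rw [← ENNReal.pow_le_pow_left_iff two_ne_zero, hsENorm_sq b, ENNReal.tsum_eq_iSup_sum]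
  refine iSup_le fun t => ?_
  have e : ∀ k, ‖A (b k)‖ₑ ^ 2 = ∫⁻ x, ‖fourierFun f (b k) x‖ₑ ^ 2 ∂coneMeasure i j := fun k => by
    rw [lintegral_enorm_sq, ← eLpNorm_congr_ae (hA (b k)), ← Lp.enorm_def]
  simp_rw [e]
  rw [← lintegral_finsetSum _ fun k _ => ((measurable_fourierFun hf
    (Lp.stronglyMeasurable (b k)).measurable).enorm.pow_const 2)]
  refine le_trans (lintegral_mono_ae ?_) (setLIntegral_fourierDensity_le hf h1 h2 i j)
  filter_upwards [ae_fourierDensity_lt_top hf h1 h2 i j] with x hx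
  obtain ⟨χ, hχ1, hχ⟩ := exists_kernel hf hx.1 hx.2
  refine le_trans ?_ hχ1
  rw [← b.tsum_enorm_inner_sq χ]
  refine le_trans (le_of_eq ?_) (ENNReal.sum_le_tsum t)
  refine Finset.sum_congr rfl fun k _ => ?_
  rw [hχ, ← inner_conj_symm, RCLike.enorm_conj]

end AffPoincare

namespace AffPoincare

/-! ### The domain of the Duflo-Moore operator is dense -/

theorem dufloWeight_nonneg (x : ℝ × ℝ) : 0 ≤ dufloWeight x := by
  have := Real.pi_pos
  unfold dufloWeight
  positivity

theorem measurable_dufloFun {φ : ℝ × ℝ → ℂ} (hφ : Measurable φ) : Measurable (dufloFun φ) := by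
  have := measurable_dufloWeight
  unfold dufloFun
  fun_prop

/-- If $\chi$ is orthogonal to the domain, then testing with $\chi/(1+w)$, which lies in the domain,
gives $\int|\chi|^2/(1+w)=0$. -/
theorem dense_dufloMoore_domain (i j : Fin 2) :
    Dense ((dufloMoore i j).domain : Set (ConeL2 i j)) := by
  rw [Submodule.dense_iff_topologicalClosure_eq_top, Submodule.topologicalClosure_eq_top_iff,
    eq_bot_iff]
  intro χ hχ
  have hm : Measurable χ := (Lp.stronglyMeasurable χ).measurable
  let r : ℝ × ℝ → ℝ := fun x => (1 + dufloWeight x)⁻¹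
  have hw := measurable_dufloWeight
  have hr : Measurable r := by fun_prop
  have hr0 : ∀ x, 0 < r x := fun x => inv_pos.2 (by linarith [dufloWeight_nonneg x])
  have hr1 : ∀ x, r x ≤ 1 := fun x => inv_le_one_of_one_le₀ (by linarith [dufloWeight_nonneg x])
  have hr2 : ∀ x, dufloWeight x * r x ≤ 1 := fun x => by
    rw [← div_eq_mul_inv, div_le_one (by linarith [dufloWeight_nonneg x])]
    linarith
  have h1 : MemLp (fun x => (r x : ℂ) * χ x) 2 (coneMeasure i j) := by
    refine (Lp.memLp χ).of_le (by fun_prop) (Eventually.of_forall fun x => ?_)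
    rw [norm_mul, Complex.norm_real, Real.norm_of_nonneg (hr0 x).le]
    exact mul_le_of_le_one_left (norm_nonneg _) (hr1 x)
  have h2 : MemLp (dufloFun (h1.toLp _)) 2 (coneMeasure i j) := by
    refine (Lp.memLp χ).of_le (measurable_dufloFun
      (Lp.stronglyMeasurable _).measurable).aestronglyMeasurable ?_
    filter_upwards [h1.coeFn_toLp] with x hx
    rw [dufloFun, hx, ← mul_assoc, norm_mul, ← Complex.ofReal_mul, Complex.norm_real,
      Real.norm_of_nonneg (mul_nonneg (dufloWeight_nonneg x) (hr0 x).le)]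
    exact mul_le_of_le_one_left (norm_nonneg _) (hr2 x)
  have h3 := (Submodule.mem_orthogonal _ _).1 hχ (h1.toLp _) h2
  have e : (fun x => inner ℂ ((h1.toLp _) x) (χ x)) =ᵐ[coneMeasure i j]
      fun x => ((r x * ‖χ x‖ ^ 2 : ℝ) : ℂ) := by
    filter_upwards [h1.coeFn_toLp] with x hx
    rw [hx, RCLike.inner_apply, map_mul, Complex.conj_ofReal, mul_left_comm, Complex.mul_conj']
    push_cast
    rfl
  have hint : Integrable (fun x => r x * ‖χ x‖ ^ 2) (coneMeasure i j) := by
    refine ((Lp.memLp χ).integrable_norm_pow two_ne_zero).mono' (by fun_prop)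
      (Eventually.of_forall fun x => ?_)
    rw [Real.norm_of_nonneg (mul_nonneg (hr0 x).le (sq_nonneg _))]
    exact mul_le_of_le_one_left (sq_nonneg _) (hr1 x)
  rw [L2.inner_def, integral_congr_ae e, integral_complex_ofReal, Complex.ofReal_eq_zero,
    integral_eq_zero_iff_of_nonneg (fun x => mul_nonneg (hr0 x).le (sq_nonneg _)) hint] at h3
  rw [Submodule.mem_bot]
  refine (Lp.eq_zero_iff_ae_eq_zero).2 ?_
  filter_upwards [h3] with x hx
  simpa [(hr0 x).ne'] using hx

/-! ### The Fourier integral -/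

theorem eLpNorm_piFun_dufloFun (g : AffPoincare) {i j : Fin 2} {φ : ConeL2 i j}
    (hφ : φ ∈ (dufloMoore i j).domain) :
    eLpNorm (piFun g (dufloFun φ)) 2 (coneMeasure i j)
      = ‖dufloMoore i j ⟨φ, hφ⟩‖ₑ := by
  rw [Lp.enorm_def, ← eLpNorm_piFun g]
  refine eLpNorm_congr_ae ?_
  filter_upwards [(quasiMeasurePreserving_dil g i j).ae_eq_comp
    (dufloMoore_coeFn (⟨φ, hφ⟩ : (dufloMoore i j).domain))] with x hx
  simp only [Function.comp_apply] at hx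
  simp only [piFun, hx]

theorem measurable_piFun {φ : ℝ × ℝ → ℂ} (hφ : Measurable φ) :
    Measurable fun z : (ℝ × ℝ) × AffPoincare => piFun z.2 φ z.1 := by
  have h : Measurable fun z : (ℝ × ℝ) × (ℝ × ℝ) × ℝ × ℝ =>
      (z.2.2.1 : ℂ) * Complex.exp (Complex.I * mink z.1 z.2.1) * φ (orbitMap z.1 z.2.2) := by
    refine Measurable.mul ?_ (hφ.comp (measurable_orbitMap_uncurry.comp
      (measurable_fst.prodMk (measurable_snd.comp measurable_snd))))
    unfold mink
    fun_prop
  exact h.comp (measurable_fst.prodMk (measurable_coords.comp measurable_snd))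

/-- The map $g\mapsto f(g)\pi(g)D\varphi$ is absolutely integrable in $L^2$, but the cone has
infinite measure. Tonelli is therefore applied after multiplication by a strictly positive `η` of
$L^2$ norm below 1, which can afterwards be divided out pointwise. -/
theorem ae_integrable_piFun {f : AffPoincare → ℂ} (hf : Measurable f) (h1 : Integrable f haar)
    {i j : Fin 2} {φ : ConeL2 i j} (hφ : φ ∈ (dufloMoore i j).domain) :
    ∀ᵐ x ∂coneMeasure i j, Integrable (fun g => f g * piFun g (dufloFun φ) x) haar := by
  have hm : Measurable fun z : (ℝ × ℝ) × AffPoincare => f z.2 * piFun z.2 (dufloFun φ) z.1 :=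
    (hf.comp measurable_snd).mul
      (measurable_piFun (measurable_dufloFun (Lp.stronglyMeasurable φ).measurable))
  obtain ⟨θ, hθ0, hθm, hθ⟩ := exists_pos_lintegral_lt_of_sigmaFinite (coneMeasure i j) one_ne_zero
  let η : ℝ × ℝ → ℝ≥0∞ := fun x => (NNReal.sqrt (θ x) : ℝ≥0∞)
  have hηm : Measurable η := (NNReal.continuous_sqrt.measurable.comp hθm).coe_nnreal_ennreal
  have hη : ∫⁻ x, η x ^ (2 : ℝ) ∂coneMeasure i j < 1 := by
    refine lt_of_le_of_lt (le_of_eq (lintegral_congr fun x => ?_)) hθ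
    simp only [η]
    rw [ENNReal.rpow_ofNat, ← ENNReal.coe_pow, NNReal.sq_sqrt]
  have hslice : ∀ g, ∫⁻ x, η x * ‖piFun g (dufloFun φ) x‖ₑ ∂coneMeasure i j
      ≤ ‖dufloMoore i j ⟨φ, hφ⟩‖ₑ := by
    intro g
    have hg : Measurable (piFun g (dufloFun φ)) := (measurable_piFun (measurable_dufloFun
      (Lp.stronglyMeasurable φ).measurable)).comp (measurable_id.prodMk measurable_const)
    refine (ENNReal.lintegral_mul_le_Lp_mul_Lq (coneMeasure i j) Real.HolderConjugate.two_two
      hηm.aemeasurable hg.enorm.aemeasurable).trans ?_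
    simp only [ENNReal.rpow_ofNat] at hη ⊢
    rw [lintegral_enorm_sq, ENNReal.sq_rpow_half, eLpNorm_piFun_dufloFun g hφ]
    exact mul_le_of_le_one_left' (ENNReal.rpow_le_one hη.le (by norm_num))
  have htot : ∫⁻ x, ∫⁻ g, η x * ‖f g * piFun g (dufloFun φ) x‖ₑ ∂haar ∂coneMeasure i j < ∞ := by
    rw [lintegral_lintegral_swap ((hηm.comp measurable_fst).mul hm.enorm).aemeasurable]
    calc ∫⁻ g, ∫⁻ x, η x * ‖f g * piFun g (dufloFun φ) x‖ₑ ∂coneMeasure i j ∂haar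
        ≤ ∫⁻ g, ‖f g‖ₑ * ‖dufloMoore i j ⟨φ, hφ⟩‖ₑ ∂haar := by
          refine lintegral_mono fun g => ?_
          simp only [enorm_mul]
          simp_rw [mul_left_comm (η _)]
          rw [lintegral_const_mul' _ _ enorm_ne_top]
          gcongr
          exact hslice g
      _ = (∫⁻ g, ‖f g‖ₑ ∂haar) * ‖dufloMoore i j ⟨φ, hφ⟩‖ₑ := lintegral_mul_const' _ _ enorm_ne_top
      _ < ∞ := ENNReal.mul_lt_top h1.2 enorm_lt_top
  have hae := ae_lt_top (((hηm.comp measurable_fst).mul hm.enorm).lintegral_prod_right') htot.ne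
  filter_upwards [hae] with x hx
  refine ⟨(hm.comp (measurable_const.prodMk measurable_id)).aestronglyMeasurable, ?_⟩
  simp only [Pi.mul_apply, Function.comp_apply] at hx
  rw [lintegral_const_mul' _ _ ENNReal.coe_ne_top] at hx
  rcases ENNReal.mul_lt_top_iff.1 hx with h | h | h
  · exact h.2
  · exact absurd h (by simpa [η] using (hθ0 x).ne')
  · rw [HasFiniteIntegral, h]
    exact ENNReal.zero_lt_top

theorem integral_piFun_eq_fourierFun {f : AffPoincare → ℂ} {i j : Fin 2} (φ : ConeL2 i j)
    {x : ℝ × ℝ} (hint : Integrable (fun g => f g * piFun g (dufloFun φ) x) haar) :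
    ∫ g, f g * piFun g (dufloFun φ) x ∂haar = fourierFun f φ x := by
  let F : (ℝ × ℝ) × ℝ × ℝ → ℂ := fun c => f (ofCoords c) *
    ((c.2.1 : ℂ) * Complex.exp (Complex.I * mink x c.1) * dufloFun φ (orbitMap x c.2))
  have e : (fun g => f g * piFun g (dufloFun φ) x) = F ∘ coords := by
    funext g
    simp only [F, Function.comp_apply, ofCoords_coords]
    rfl
  have hF : Integrable F (volume.prod scaleMeasure) := by
    rw [e] at hint
    exact (measurePreserving_coords.integrable_comp_emb measurableEmbedding_coords).1 hint
  rw [e]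
  change ∫ g, F (coords g) ∂haar = _
  rw [measurePreserving_coords.integral_comp measurableEmbedding_coords, integral_prod_symm _ hF]
  refine integral_congr_ae ?_
  filter_upwards [ae_scaleMeasure_pos] with s hs
  -- Homogeneity of the multiplier: this supplies the second factor $a$ in the weight $a^2$ of
  -- `fourierFun`.
  have hw : dufloWeight (orbitMap x s) = s.1 * dufloWeight x := by
    have h := sq_sub_sq_dil ⟨0, s.1, s.2, hs⟩ x
    have h' : mink (orbitMap x s) (orbitMap x s) = s.1 ^ 2 * mink x x := by
      simp only [mink, ← sq]
      exact h
    rw [dufloWeight, dufloWeight, h', abs_mul, abs_of_pos (by positivity),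
      Real.sqrt_mul (by positivity), Real.sqrt_sq hs.le]
    ring
  simp only [F, partialFourier, minkFourier, dufloFun, hw]
  rw [← integral_mul_const, ← integral_mul_const]
  refine integral_congr_ae (Eventually.of_forall fun b => ?_)
  push_cast
  ring

theorem fourierL1_spec {f : AffPoincare → ℂ} (hf : Measurable f)
    (h1 : Integrable f haar) (h2 : MemLp f 2 haar) (i j : Fin 2) :
    (∀ φ ∈ (dufloMoore i j).domain, fourierL1 i j f φ =ᵐ[coneMeasure i j]
      fun x => ∫ g, f g * piFun g (dufloFun φ) x ∂haar) ∧
    hsENorm (fourierL1 i j f) ≤ eLpNorm f 2 haar := by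
  obtain ⟨A, hA, hAn⟩ := exists_fourierOp hf h1 h2 i j
  have hA' : ∀ φ ∈ (dufloMoore i j).domain, A φ =ᵐ[coneMeasure i j]
      fun x => ∫ g, f g * piFun g (dufloFun φ) x ∂haar := by
    intro φ hφ
    filter_upwards [hA φ, ae_integrable_piFun hf h1 hφ] with x hx1 hx2
    rw [hx1, integral_piFun_eq_fourierFun φ hx2]
  have hex : ∃ A : ConeL2 i j →L[ℂ] ConeL2 i j, ∀ φ ∈ (dufloMoore i j).domain,
      A φ =ᵐ[coneMeasure i j] fun x => ∫ g, f g * piFun g (dufloFun φ) x ∂haar := ⟨A, hA'⟩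
  have hB : fourierL1 i j f = hex.choose := dif_pos hex
  have hspec := hex.choose_spec
  rw [← hB] at hspec
  -- The operator picked by choice agrees with the integral operator on a dense domain, hence
  -- inherits its Hilbert-Schmidt bound.
  have hAB : fourierL1 i j f = A := by
    refine ContinuousLinearMap.coeFn_injective ((fourierL1 i j f).continuous.ext_on
      (dense_dufloMoore_domain i j) A.continuous fun φ hφ => ?_)
    exact Lp.ext ((hspec φ hφ).trans (hA' φ hφ).symm)
  exact ⟨hspec, hAB ▸ hAn⟩

theorem fourierL1_unique {f : AffPoincare → ℂ} (hf : Measurable f)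
    (h1 : Integrable f haar) (h2 : MemLp f 2 haar) {i j : Fin 2} {A : ConeL2 i j →L[ℂ] ConeL2 i j}
    (hA : ∀ φ ∈ (dufloMoore i j).domain, A φ =ᵐ[coneMeasure i j]
      fun x => ∫ g, f g * piFun g (dufloFun φ) x ∂haar) : fourierL1 i j f = A := by
  refine ContinuousLinearMap.coeFn_injective ((fourierL1 i j f).continuous.ext_on
    (dense_dufloMoore_domain i j) A.continuous fun φ hφ => ?_)
  exact Lp.ext (((fourierL1_spec hf h1 h2 i j).1 φ hφ).trans (hA φ hφ).symm)

/-! ### The extension to `L²` -/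

/-- The subspace `L¹ ∩ L²` of `L²`. -/
def integrableL2 : Submodule ℂ (Lp ℂ 2 haar) where
  carrier := {h | Integrable h haar}
  add_mem' hf hg := (integrable_congr (Lp.coeFn_add _ _)).2 (Integrable.add hf hg)
  zero_mem' := (integrable_congr (Lp.coeFn_zero _ _ _)).2 (integrable_zero _ _ _)
  smul_mem' c _ hf := (integrable_congr (Lp.coeFn_smul _ _)).2 (Integrable.smul c hf)

theorem dense_integrableL2 : Dense (integrableL2 : Set (Lp ℂ 2 haar)) := by
  refine (Lp.simpleFunc.dense (E := ℂ) (μ := haar) (p := 2) (by simp)).mono fun f hf => ?_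
  let F : Lp.simpleFunc ℂ 2 haar := ⟨f, hf⟩
  have h := Lp.simpleFunc.toSimpleFunc_eq_toFun F
  have h2 : MemLp (Lp.simpleFunc.toSimpleFunc F) 2 haar := Lp.simpleFunc.memLp F
  exact ((SimpleFunc.memLp_iff_integrable two_ne_zero (by simp)).1 h2).congr h

/-- The Fourier transform as a continuous linear map on `L¹ ∩ L²`. -/
def fourierIntegrable (i j : Fin 2) : integrableL2 →L[ℂ] (ConeL2 i j →L[ℂ] ConeL2 i j) :=
  LinearMap.mkContinuous
    { toFun := fun f => fourierL1 i j f
      map_add' := by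
        intro f g
        have hm : ∀ f : Lp ℂ 2 haar, Measurable f := fun f => (Lp.stronglyMeasurable f).measurable
        refine fourierL1_unique (hm _) (f + g).2 (Lp.memLp _) fun φ hφ => ?_
        rw [add_apply]
        filter_upwards [Lp.coeFn_add (fourierL1 i j f φ) (fourierL1 i j g φ),
          (fourierL1_spec (hm f) f.2 (Lp.memLp _) i j).1 φ hφ,
          (fourierL1_spec (hm g) g.2 (Lp.memLp _) i j).1 φ hφ,
          ae_integrable_piFun (hm f) f.2 hφ, ae_integrable_piFun (hm g) g.2 hφ]
          with x h1 h2 h3 h4 h5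
        rw [h1, Pi.add_apply, h2, h3, ← integral_add h4 h5]
        refine integral_congr_ae ?_
        filter_upwards [Lp.coeFn_add (f : Lp ℂ 2 haar) g] with y hy
        rw [Submodule.coe_add, hy, Pi.add_apply, add_mul]
      map_smul' := by
        intro c f
        have hm : ∀ f : Lp ℂ 2 haar, Measurable f := fun f => (Lp.stronglyMeasurable f).measurable
        refine fourierL1_unique (hm _) (c • f).2 (Lp.memLp _) fun φ hφ => ?_
        rw [RingHom.id_apply, smul_apply]
        filter_upwards [Lp.coeFn_smul c (fourierL1 i j f φ),
          (fourierL1_spec (hm f) f.2 (Lp.memLp _) i j).1 φ hφ] with x h1 h2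
        rw [h1, Pi.smul_apply, h2, smul_eq_mul, ← integral_const_mul]
        refine integral_congr_ae ?_
        filter_upwards [Lp.coeFn_smul c (f : Lp ℂ 2 haar)] with y hy
        rw [Submodule.coe_smul, hy, Pi.smul_apply, smul_eq_mul, mul_assoc] }
    1 (by
      intro f
      simp only [LinearMap.coe_mk, AddHom.coe_mk, one_mul]
      have h := (enorm_le_hsENorm _).trans (fourierL1_spec (Lp.stronglyMeasurable _).measurable f.2
        (Lp.memLp (f : Lp ℂ 2 haar)) i j).2
      rw [← Lp.enorm_def, ← ofReal_norm, ← ofReal_norm] at h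
      exact (ENNReal.ofReal_le_ofReal_iff (norm_nonneg _)).1 h)

/-- The Fourier transform as a continuous linear map on `L²`. -/
def fourierCLM (i j : Fin 2) : Lp ℂ 2 haar →L[ℂ] (ConeL2 i j →L[ℂ] ConeL2 i j) :=
  (fourierIntegrable i j).extend integrableL2.subtypeL

theorem fourierCLM_apply_coe (i j : Fin 2) (f : integrableL2) :
    fourierCLM i j f = fourierL1 i j f :=
  ContinuousLinearMap.extend_eq (e := integrableL2.subtypeL) _
    (dense_integrableL2.denseRange_val) isUniformEmbedding_subtype_val.isUniformInducing f

/-- `extendFrom` is a limit along $L^1\cap L^2$, and the continuous linear extension has the same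
limit. -/
theorem fourier_eq_fourierCLM (i j : Fin 2) (f : Lp ℂ 2 haar) :
    fourier i j f = fourierCLM i j f := by
  refine extendFrom_eq (dense_integrableL2 f) ?_
  refine ((fourierCLM i j).continuous.continuousWithinAt (s := integrableL2) (x := f)).congr' ?_
  filter_upwards [self_mem_nhdsWithin] with g hg
  exact fourierCLM_apply_coe i j ⟨g, hg⟩

/-- The Plancherel inequality: the Hilbert-Schmidt norm of the Fourier transform is at most
the `L²` norm. -/
theorem hsENorm_fourierCLM_le (i j : Fin 2) (f : Lp ℂ 2 haar) :
    hsENorm (fourierCLM i j f) ≤ ‖f‖ₑ := by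
  obtain ⟨b, -⟩ := (exists_hilbertBasis ℂ (ConeL2 i j)).choose_spec
  rw [← ENNReal.pow_le_pow_left_iff two_ne_zero, hsENorm_sq b, ENNReal.tsum_eq_iSup_sum]
  refine iSup_le fun t => ?_
  -- A finite partial sum is continuous in $f$ for the operator norm, so its bound passes from the
  -- dense subspace to the limit.
  have hc : IsClosed {f : Lp ℂ 2 haar | ∑ k ∈ t, ‖fourierCLM i j f (b k)‖ₑ ^ 2 ≤ ‖f‖ₑ ^ 2} :=
    isClosed_le (by fun_prop) (by fun_prop)
  refine hc.closure_subset_iff.2 (fun g hg => ?_) (dense_integrableL2 f)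
  have h := (fourierL1_spec (Lp.stronglyMeasurable g).measurable hg (Lp.memLp g) i j).2
  rw [← Lp.enorm_def, ← ENNReal.pow_le_pow_left_iff two_ne_zero, hsENorm_sq b] at h
  rw [Set.mem_ofPred_eq, fourierCLM_apply_coe i j ⟨g, hg⟩]
  exact (ENNReal.sum_le_tsum t).trans h

end AffPoincare

/-! ### Measurability of sums, and the trace of a product. -/

theorem aemeasurable_of_hasSum {α ι : Type*} [MeasurableSpace α] {μ : Measure α} [Countable ι]
    {F : ι → α → ℂ} {G : α → ℂ} (hF : ∀ k, AEMeasurable (F k) μ)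
    (h : ∀ x, HasSum (fun k => F k x) (G x)) : AEMeasurable G μ := by
  refine aemeasurable_of_tendsto_metrizable_ae (atTop : Filter (Finset ι))
    (f := fun t x => ∑ k ∈ t, F k x) (fun t => Finset.aemeasurable_fun_sum t fun k _ => hF k)
    (Eventually.of_forall fun x => ?_)
  simpa [HasSum] using h x

section HilbertSchmidt

variable {H : Type*} [NormedAddCommGroup H] [InnerProductSpace ℂ H]

/-- Distinct members are at distance $\sqrt2$, so balls of radius $1/2$ around them are disjoint. -/
theorem Orthonormal.countable [TopologicalSpace.SeparableSpace H] {ι : Type*} {v : ι → H}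
    (hv : Orthonormal ℂ v) : Countable ι := by
  refine Pairwise.countable_of_isOpen_disjoint (s := fun k => Metric.ball (v k) (1 / 2)) ?_
    (fun k => Metric.isOpen_ball) (fun k => ⟨v k, Metric.mem_ball_self (by norm_num)⟩)
  intro k l hkl
  refine Metric.ball_disjoint_ball ?_
  have h1 : ‖v k - v l‖ ^ 2 = 2 := by
    rw [@norm_sub_sq ℂ, hv.2 hkl, hv.1, hv.1]
    norm_num
  rw [dist_eq_norm]
  nlinarith [norm_nonneg (v k - v l)]

variable [CompleteSpace H]

/-- Needed for additivity of the trace and its limit representation, since `tsum` is 0 on a family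
that is not summable. -/
theorem summable_opTrace_comp {A B : H →L[ℂ] H} (hA : hsENorm A < ∞) (hB : hsENorm B < ∞) :
    Summable fun e : (exists_hilbertBasis ℂ H).choose => inner ℂ (e : H) ((A ∘L B) e) := by
  refine Summable.of_norm ?_
  have h := ((tsum_enorm_opTrace_comp_le A B).trans_lt (ENNReal.mul_lt_top hA hB)).ne
  simpa only [toReal_enorm] using ENNReal.summable_toReal h

theorem enorm_opTrace_comp_le (A B : H →L[ℂ] H) :
    ‖opTrace (A ∘L B)‖ₑ ≤ hsENorm A * hsENorm B :=
  enorm_tsum_le_tsum_enorm.trans (tsum_enorm_opTrace_comp_le A B)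

end HilbertSchmidt

/-! ### Measurability, linearity and bounds of the pseudo-differential operator. -/

namespace AffPoincare

theorem inner_dufloMoore {i j : Fin 2} (φ ψ : (dufloMoore i j).domain) :
    inner ℂ (φ : ConeL2 i j) (dufloMoore i j ψ) = inner ℂ (dufloMoore i j φ) (ψ : ConeL2 i j) := by
  rw [L2.inner_def, L2.inner_def]
  refine integral_congr_ae ?_
  filter_upwards [dufloMoore_coeFn φ, dufloMoore_coeFn ψ] with x h1 h2
  simp only [h1, h2, dufloFun, RCLike.inner_apply, map_mul, Complex.conj_ofReal]
  ring

/-- For $u$ in the domain, $\langle u,DS\varphi\rangle=\langle Du,S\varphi\rangle$ is measurable by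
hypothesis; a general $\psi$ is a limit of such $u$. -/
theorem aemeasurable_inner_dufloComp {i j : Fin 2} {S : AffPoincare → ConeL2 i j →L[ℂ] ConeL2 i j}
    (hmeas : ∀ φ ψ : ConeL2 i j, AEMeasurable (fun g => inner ℂ ψ (S g φ)) haar)
    (hS : ∀ g φ, S g φ ∈ (dufloMoore i j).domain) (φ ψ : ConeL2 i j) :
    AEMeasurable (fun g => inner ℂ ψ (dufloComp (S g) (hS g) φ)) haar := by
  obtain ⟨u, hu, hlim⟩ := mem_closure_iff_seq_limit.1 (dense_dufloMoore_domain i j ψ)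
  refine aemeasurable_of_tendsto_metrizable_ae atTop
    (f := fun n g => inner ℂ (u n) (dufloComp (S g) (hS g) φ)) (fun n => ?_)
    (Eventually.of_forall fun g => hlim.inner tendsto_const_nhds)
  have e : (fun g => inner ℂ (u n) (dufloComp (S g) (hS g) φ))
      = fun g => inner ℂ (dufloMoore i j ⟨u n, hu n⟩) (S g φ) := by
    funext g
    exact inner_dufloMoore ⟨u n, hu n⟩ ⟨S g φ, hS g φ⟩
  rw [e]
  exact hmeas _ _

theorem piOp_coeFn {i j : Fin 2} (g : AffPoincare) (φ : ConeL2 i j) :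
    piOp i j g φ =ᵐ[coneMeasure i j] piFun g φ :=
  MemLp.coeFn_toLp (memLp_piFun g φ)

theorem measurable_inner_piOp {i j : Fin 2} (φ ψ : ConeL2 i j) :
    Measurable fun g => inner ℂ (piOp i j g φ) ψ := by
  have h : Measurable fun z : (ℝ × ℝ) × AffPoincare => ψ z.1 * starRingEnd ℂ (piFun z.2 φ z.1) :=
    ((Lp.stronglyMeasurable ψ).measurable.comp measurable_fst).mul
      (Complex.continuous_conj.measurable.comp
        (measurable_piFun (Lp.stronglyMeasurable φ).measurable))
  have e : (fun g => inner ℂ (piOp i j g φ) ψ)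
      = fun g => ∫ x, ψ x * starRingEnd ℂ (piFun g φ x) ∂coneMeasure i j := by
    funext g
    rw [L2.inner_def]
    refine integral_congr_ae ?_
    filter_upwards [piOp_coeFn g φ] with x hx
    rw [hx, RCLike.inner_apply]
  rw [e]
  exact h.stronglyMeasurable.integral_prod_left'.measurable

theorem norm_adjoint_piOp_le (i j : Fin 2) (g : AffPoincare) :
    ‖ContinuousLinearMap.adjoint (piOp i j g)‖ₑ ≤ 1 := by
  rw [← ofReal_norm, LinearIsometryEquiv.norm_map]
  exact ENNReal.ofReal_le_one.2 (LinearMap.mkContinuous_norm_le _ zero_le_one _)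

theorem hsENorm_fourier_comp_le (i j : Fin 2) (f : Lp ℂ 2 haar) (g : AffPoincare) :
    hsENorm (fourier i j f ∘L ContinuousLinearMap.adjoint (piOp i j g)) ≤ ‖f‖ₑ := by
  rw [fourier_eq_fourierCLM]
  refine (hsENorm_comp_le_right _ _).trans ?_
  exact (mul_le_of_le_one_right' (norm_adjoint_piOp_le i j g)).trans (hsENorm_fourierCLM_le i j f)

theorem measurable_modular_rpow : Measurable fun g => modular g ^ (-(1 / 2) : ℝ) := by
  have h : Measurable fun g : AffPoincare => g.a :=
    measurable_fst.comp (measurable_snd.comp measurable_coords)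
  unfold modular
  exact (measurable_const.div (h.pow_const 2)).pow_const _

variable {σ : OpSymbol} {hσ : ∀ i j g φ, σ i j g φ ∈ (dufloMoore i j).domain}

theorem symbolOp_eq (f : Lp ℂ 2 haar) (g : AffPoincare) (i j : Fin 2) :
    symbolOp σ hσ f g i j = dufloComp (σ i j g) (hσ i j g) ∘L
      (fourier i j f ∘L ContinuousLinearMap.adjoint (piOp i j g)) := rfl

theorem aemeasurable_opTrace_symbolOp
    (hmeas : ∀ (i j : Fin 2) (φ ψ : ConeL2 i j),
      AEMeasurable (fun g => inner ℂ ψ (σ i j g φ)) haar) {i j : Fin 2}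
    (hA : ∀ g, hsENorm (dufloComp (σ i j g) (hσ i j g)) < ∞) (f : Lp ℂ 2 haar) :
    AEMeasurable (fun g => opTrace (symbolOp σ hσ f g i j)) haar := by
  have : Fact ((2 : ℝ≥0∞) ≠ ∞) := ⟨by simp⟩
  have hcount : Countable (exists_hilbertBasis ℂ (ConeL2 i j)).choose :=
    orthonormal_hilbertBasis_choose.countable
  obtain ⟨b, -⟩ := (exists_hilbertBasis ℂ (ConeL2 i j)).choose_spec
  refine aemeasurable_of_hasSum (fun e => ?_) fun g => (summable_opTrace_comp (hA g)
    ((hsENorm_fourier_comp_le i j f g).trans_lt enorm_lt_top)).hasSum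
  -- Insertion of a second basis, $\langle e,ABe\rangle=\sum_k\langle e,Ab_k\rangle\langle
  -- b_k,Be\rangle$, separates the symbol from the representation, each of which is weakly
  -- measurable.
  refine aemeasurable_of_hasSum
    (F := fun k g => inner ℂ (e : ConeL2 i j) (dufloComp (σ i j g) (hσ i j g) (b k)) *
      inner ℂ (piOp i j g (ContinuousLinearMap.adjoint (fourier i j f) (b k))) (e : ConeL2 i j))
    (fun k => ?_) fun g => ?_
  · exact (aemeasurable_inner_dufloComp (hmeas i j) (hσ i j) _ _).mul
      (measurable_inner_piOp _ _).aemeasurable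
  · have h := b.hasSum_inner_mul_inner
      (ContinuousLinearMap.adjoint (dufloComp (σ i j g) (hσ i j g)) (e : ConeL2 i j))
      ((fourier i j f ∘L ContinuousLinearMap.adjoint (piOp i j g)) e)
    simpa only [ContinuousLinearMap.adjoint_inner_left, ContinuousLinearMap.comp_apply,
      ← ContinuousLinearMap.adjoint_inner_right (piOp i j g),
      ContinuousLinearMap.adjoint_inner_left (fourier i j f)] using h

theorem aemeasurable_pseudoDiff
    (hmeas : ∀ (i j : Fin 2) (φ ψ : ConeL2 i j),
      AEMeasurable (fun g => inner ℂ ψ (σ i j g φ)) haar)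
    (hA : ∀ i j g, hsENorm (dufloComp (σ i j g) (hσ i j g)) < ∞) (f : Lp ℂ 2 haar) :
    AEMeasurable (pseudoDiff σ hσ f) haar := by
  refine (Complex.measurable_ofReal.comp measurable_modular_rpow).aemeasurable.mul ?_
  exact Finset.aemeasurable_fun_sum _ fun i _ => Finset.aemeasurable_fun_sum _ fun j _ =>
    aemeasurable_opTrace_symbolOp hmeas (hA i j) f

theorem pseudoDiff_add (hA : ∀ i j g, hsENorm (dufloComp (σ i j g) (hσ i j g)) < ∞)
    (f h : Lp ℂ 2 haar) : pseudoDiff σ hσ (f + h) = pseudoDiff σ hσ f + pseudoDiff σ hσ h := by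
  funext g
  have key : ∀ i j, opTrace (symbolOp σ hσ (f + h) g i j)
      = opTrace (symbolOp σ hσ f g i j) + opTrace (symbolOp σ hσ h g i j) := by
    intro i j
    rw [opTrace, opTrace, opTrace, symbolOp_eq, symbolOp_eq, symbolOp_eq,
      ← (summable_opTrace_comp (hA i j g)
        ((hsENorm_fourier_comp_le i j f g).trans_lt enorm_lt_top)).tsum_add
      (summable_opTrace_comp (hA i j g)
        ((hsENorm_fourier_comp_le i j h g).trans_lt enorm_lt_top))]
    refine tsum_congr fun e => ?_
    rw [← inner_add_right]
    simp only [ContinuousLinearMap.comp_apply, fourier_eq_fourierCLM, map_add, add_apply]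
  simp only [pseudoDiff, Pi.add_apply, key, Finset.sum_add_distrib, mul_add]

theorem pseudoDiff_smul (c : ℂ) (f : Lp ℂ 2 haar) :
    pseudoDiff σ hσ (c • f) = c • pseudoDiff σ hσ f := by
  funext g
  have key : ∀ i j, opTrace (symbolOp σ hσ (c • f) g i j)
      = c * opTrace (symbolOp σ hσ f g i j) := by
    intro i j
    -- Over a field a scalar leaves `tsum` even without summability.
    rw [opTrace, opTrace, ← tsum_mul_left]
    refine tsum_congr fun e => ?_
    rw [← inner_smul_right]
    simp only [symbolOp_eq, ContinuousLinearMap.comp_apply, fourier_eq_fourierCLM, map_smul,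
      smul_apply]
  simp only [pseudoDiff, Pi.smul_apply, key, smul_eq_mul, ← Finset.mul_sum]
  ring

/-- Cauchy-Schwarz for the trace, with the symbol estimated through $S_q\subset S_2$ and the other
factor by the Plancherel inequality. -/
theorem norm_pseudoDiff_le {q : ℝ≥0∞} (hq1 : 1 ≤ q) (hq2 : q ≤ 2)
    (hq : ∀ i j g, MemSchatten q (dufloComp (σ i j g) (hσ i j g)))
    (f : Lp ℂ 2 haar) (g : AffPoincare) :
    ‖pseudoDiff σ hσ f g‖ ≤ ‖f‖ * ∑ i, ∑ j, symbolNorm q σ hσ i j g := by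
  have hqt : q ≠ ∞ := ne_top_of_le_ne_top (by simp) hq2
  have hΔ : 0 ≤ modular g ^ (-(1 / 2) : ℝ) :=
    Real.rpow_nonneg (div_nonneg zero_le_one (sq_nonneg _)) _
  have key : ∀ i j, ‖opTrace (symbolOp σ hσ f g i j)‖
      ≤ schattenNorm q (dufloComp (σ i j g) (hσ i j g)) * ‖f‖ := by
    intro i j
    have h : ‖opTrace (symbolOp σ hσ f g i j)‖ₑ
        ≤ schattenENorm q (dufloComp (σ i j g) (hσ i j g)) * ‖f‖ₑ :=
      (enorm_opTrace_comp_le _ _).trans (mul_le_mul'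
        (hsENorm_le_schattenENorm hq1 hq2 ((hq i j g).1 hqt)) (hsENorm_fourier_comp_le i j f g))
    have := ENNReal.toReal_mono (ENNReal.mul_lt_top (hq i j g).2 enorm_lt_top).ne h
    rwa [ENNReal.toReal_mul, toReal_enorm, toReal_enorm] at this
  rw [pseudoDiff, norm_mul, Complex.norm_real, Real.norm_of_nonneg hΔ]
  simp only [symbolNorm, ← Finset.mul_sum]
  rw [mul_left_comm]
  refine mul_le_mul_of_nonneg_left ?_ hΔ
  rw [mul_comm, Finset.sum_mul]
  refine (norm_sum_le _ _).trans (Finset.sum_le_sum fun i _ => ?_)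
  rw [Finset.sum_mul]
  exact (norm_sum_le _ _).trans (Finset.sum_le_sum fun j _ => key i j)

theorem eLpNorm_pseudoDiff_le {p q : ℝ≥0∞} (hp1 : 1 ≤ p) (hq1 : 1 ≤ q) (hq2 : q ≤ 2)
    (hq : ∀ i j g, MemSchatten q (dufloComp (σ i j g) (hσ i j g)))
    (hG : ∀ i j, MemLp (symbolNorm q σ hσ i j) p haar) (f : Lp ℂ 2 haar) :
    eLpNorm (pseudoDiff σ hσ f) p haar
      ≤ ENNReal.ofReal ‖f‖ * ∑ i, ∑ j, eLpNorm (symbolNorm q σ hσ i j) p haar := by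
  refine (eLpNorm_le_mul_eLpNorm_of_ae_le_mul
    (c := ‖f‖)
    (g := ∑ i, ∑ j, symbolNorm q σ hσ i j) (Eventually.of_forall fun g => ?_) p).trans ?_
  · refine (norm_pseudoDiff_le hq1 hq2 hq f g).trans ?_
    refine mul_le_mul_of_nonneg_left ?_ (norm_nonneg _)
    simp only [Finset.sum_apply]
    exact Real.le_norm_self _
  · gcongr
    refine (eLpNorm_sum_le (fun i _ => Finset.aestronglyMeasurable_sum _
      fun j _ => (hG i j).1) hp1).trans (Finset.sum_le_sum fun i _ => ?_)
    exact eLpNorm_sum_le (fun j _ => (hG i j).1) hp1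

end AffPoincare

end

/-! ### The boundedness theorem. -/

theorem mainTheorem5 (p q : ℝ≥0∞) [Fact (1 ≤ p)] (hp : 2 ≤ p) (hpq : p⁻¹ + q⁻¹ = 1)
    (σ : AffPoincare.OpSymbol)
    (hmeas : ∀ (i j : Fin 2) (φ ψ : AffPoincare.ConeL2 i j),
      AEMeasurable (fun g => inner ℂ ψ (σ i j g φ)) AffPoincare.haar)
    (hdom : ∀ i j g φ, σ i j g φ ∈ (AffPoincare.dufloMoore i j).domain)
    (hq : ∀ i j g, MemSchatten q (AffPoincare.dufloComp (σ i j g) (hdom i j g)))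
    (hG : ∀ i j, MemLp (AffPoincare.symbolNorm q σ hdom i j) p AffPoincare.haar) :
    (∀ (f : Lp ℂ 2 AffPoincare.haar) (g : AffPoincare) (i j : Fin 2),
      MemSchatten 1 (AffPoincare.symbolOp σ hdom f g i j)) ∧
    ∃ T : Lp ℂ 2 AffPoincare.haar →L[ℂ] Lp ℂ p AffPoincare.haar,
      (∀ f, T f =ᵐ[AffPoincare.haar] AffPoincare.pseudoDiff σ hdom f) ∧
      ‖T‖ ≤ ∑ i, ∑ j,
        (eLpNorm (AffPoincare.symbolNorm q σ hdom i j) p AffPoincare.haar).toReal := by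
  have hp1 : 1 ≤ p := Fact.out
  have hq1 : 1 ≤ q := by
    rw [← ENNReal.inv_le_one, ← hpq]
    exact le_add_self
  -- If $q>2$, then $1/p+1/q<1/2+1/2=1$. This is the only place where $p\ge2$ enters.
  have hq2 : q ≤ 2 := by
    by_contra! h
    have h1 : p⁻¹ ≤ 2⁻¹ := ENNReal.inv_le_inv.2 hp
    have h2 : q⁻¹ < 2⁻¹ := ENNReal.inv_lt_inv.2 h
    have h3 := ENNReal.add_lt_add_of_le_of_lt (ne_top_of_le_ne_top (by simp) h1) h1 h2
    rw [hpq, ENNReal.inv_two_add_inv_two] at h3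
    exact lt_irrefl _ h3
  have hqt : q ≠ ∞ := ne_top_of_le_ne_top (by simp) hq2
  have hA : ∀ i j g, hsENorm (AffPoincare.dufloComp (σ i j g) (hdom i j g)) < ∞ := fun i j g =>
    (hsENorm_le_schattenENorm hq1 hq2 ((hq i j g).1 hqt)).trans_lt (hq i j g).2
  refine ⟨fun f g i j => ?_, ?_⟩
  · have hc : IsCompactOperator (AffPoincare.symbolOp σ hdom f g i j) :=
      ((hq i j g).1 hqt).comp_clm _
    refine ⟨fun _ => hc, (schattenENorm_one_comp_le _ _ hc).trans_lt ?_⟩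
    exact ENNReal.mul_lt_top (hA i j g)
      ((AffPoincare.hsENorm_fourier_comp_le i j f g).trans_lt enorm_lt_top)
  have hle := AffPoincare.eLpNorm_pseudoDiff_le hp1 hq1 hq2 hq hG
  have hfin : ∀ i j, eLpNorm (AffPoincare.symbolNorm q σ hdom i j) p AffPoincare.haar ≠ ∞ :=
    fun i j => (hG i j).2.ne
  have hsum : ∑ i, ∑ j, eLpNorm (AffPoincare.symbolNorm q σ hdom i j) p AffPoincare.haar ≠ ∞ :=
    ENNReal.sum_ne_top.2 fun i _ => ENNReal.sum_ne_top.2 fun j _ => hfin i j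
  have hL : ∀ f, MemLp (AffPoincare.pseudoDiff σ hdom f) p AffPoincare.haar := fun f =>
    ⟨(AffPoincare.aemeasurable_pseudoDiff hmeas hA f).aestronglyMeasurable,
      (hle f).trans_lt (ENNReal.mul_lt_top ENNReal.ofReal_lt_top hsum.lt_top)⟩
  refine ⟨LinearMap.mkContinuous
    { toFun := fun f => (hL f).toLp _
      map_add' := fun f h => by
        rw [← MemLp.toLp_add]
        exact MemLp.toLp_congr _ _ (by rw [AffPoincare.pseudoDiff_add hA])
      map_smul' := fun c f => by
        rw [RingHom.id_apply, ← MemLp.toLp_const_smul]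
        exact MemLp.toLp_congr _ _ (by rw [AffPoincare.pseudoDiff_smul]) }
    (∑ i, ∑ j, (eLpNorm (AffPoincare.symbolNorm q σ hdom i j) p AffPoincare.haar).toReal) ?_,
    fun f => (hL f).coeFn_toLp, LinearMap.mkContinuous_norm_le _ ?_ _⟩
  · intro f
    have h := ENNReal.toReal_mono (ENNReal.mul_lt_top ENNReal.ofReal_lt_top hsum.lt_top).ne (hle f)
    rw [ENNReal.toReal_mul, ENNReal.toReal_ofReal (norm_nonneg _), ENNReal.toReal_sum
      fun i _ => ENNReal.sum_ne_top.2 fun j _ => hfin i j] at h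
    simp only [LinearMap.coe_mk, AddHom.coe_mk, Lp.norm_toLp]
    rw [mul_comm]
    refine h.trans (le_of_eq ?_)
    congr 1
    exact Finset.sum_congr rfl fun i _ => ENNReal.toReal_sum fun j _ => hfin i j
  · exact Finset.sum_nonneg fun i _ => Finset.sum_nonneg fun j _ => ENNReal.toReal_nonneg
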